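/- Let $X$ be a complex Banach space and let $T(\cdot)$ be an exponentially stable $C_0$-semigroup on $X$ with generator $A$, resolvent $R(\lambda,A)=(\lambda I-A)^{-1}$, and dual space $X'$. Let $\mathcal H^\infty_-$ be the algebra of bounded holomorphic functions $g$ on $\{z\in\mathbb C:\operatorname{Re}z<0\}$, identified with their boundary functions on $i\mathbb R$ (limits along horizontal lines, which exist almost everywhere). Let $\mathfrak L$ be the Laplace transform, let $\mathcal H^2\subset L^2(i\mathbb R)$ be the image of $L^2(0,\infty)$ under $\mathfrak L$ (as boundary values), and let $\Pi$ be the orthogonal projection of $L^2(i\mathbb R)$ onto $\mathcal H^2$. For $g\in\mathcal H^\infty_-$ let $M_gf=\mathfrak L^{-1}\Pi(g\cdot\mathfrak Lf)$ for $f\in L^2(0,\infty)$. Let $g(A)\colon D(A)\to X$ be the linear operator, bounded with respect to the graph norm on $D(A)$, such that $$M_g\big(\langle y,T(\cdot)x\rangle\big)=\langle y,g(A)T(\cdot)x\rangle\quad\text{in }L^2(0,\infty)\qquad\text{for all }x\in D(A),\ y\in X';$$ such an operator exists and is unique. Let $g_\Lambda(A)$ be its Lambda extension $$g_\Lambda(A)x=\lim_{\lambda\to+\infty}\lambda\,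 g(A)R(\lambda,A)x,\qquad D(g_\Lambda(A))=\{x\in X:\text{this limit exists in }X\}.$$ Operator sums have domain $D(F+G)=D(F)\cap D(G)$, products have domain $D(FG)=\{x\in D(G):Gx\in D(F)\}$, and $F\supset G$ means that $F$ extends $G$. Then, for all $g_1,g_2\in\mathcal H^\infty_-$: 1. if $g\equiv1$, then $g(A)x=x$ for all $x\in D(A)$, and $g_\Lambda(A)=I$ with domain $X$; 2. $(g_1+g_2)_\Lambda(A)\supset g_{1,\Lambda}(A)+g_{2,\Lambda}(A)$; 3. $(g_1g_2)_\Lambda(A)\supset g_{1,\Lambda}(A)\,g_{2,\Lambda}(A)$, and $D\big(g_{1,\Lambda}(A)\,g_{2,\Lambda}(A)\big)=D\big((g_1g_2)_\Lambda(A)\big)\cap D\big(g_{2,\Lambda}(A)\big)$. If $g_2(A)$ is bounded, i.e. $\|g_2(A)x\|\le K\|x\|$ for some $K$ and all $x\in D(A)$, then equality of operators (including domains) holds in 2 and 3. -/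

import Mathlib

open Filter Topology MeasureTheory FourierTransform
open scoped ENNReal NNReal

noncomputable section

namespace WeakCalc

/-! ### Partially defined operators -/

section Operators

variable {X : Type*} [NormedAddCommGroup X] [NormedSpace ℂ X]

/-- The strong limit of a family of linear maps `F i` along a filter `l`, as an operator whose
domain consists of exactly those `x` for which `lim F i x` exists in `X`. -/
def strongLim {ι : Type*} (l : Filter ι) [l.NeBot] (F : ι → X →ₗ[ℂ] X) : X →ₗ.[ℂ] X where
  domain :=
    { carrier := {x | ∃ z, Tendsto (fun i => F i x) l (𝓝 z)}
      add_mem' := by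
        rintro x y ⟨z, hz⟩ ⟨w, hw⟩
        exact ⟨z + w, by simpa using hz.add hw⟩
      zero_mem' := ⟨0, by simp⟩
      smul_mem' := by
        rintro c x ⟨z, hz⟩
        exact ⟨c • z, by simpa using hz.const_smul c⟩ }
  toFun :=
    { toFun := fun x => limUnder l (fun i => F i (x : X))
      map_add' := by
        rintro ⟨x, hx⟩ ⟨y, hy⟩
        have h1 := tendsto_nhds_limUnder hx
        have h2 := tendsto_nhds_limUnder hy
        exact Tendsto.limUnder_eq (by simpa using h1.add h2)
      map_smul' := by
        rintro c ⟨x, hx⟩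
        have h1 := tendsto_nhds_limUnder hx
        exact Tendsto.limUnder_eq (by simpa using h1.const_smul c) }

/-- The product `F G` of two operators, with its maximal domain
`{x ∈ D(G) | G x ∈ D(F)}`. -/
def opMul (F G : X →ₗ.[ℂ] X) : X →ₗ.[ℂ] X where
  domain :=
    { carrier := {x | ∃ h : x ∈ G.domain, G ⟨x, h⟩ ∈ F.domain}
      add_mem' := by
        rintro x y ⟨hx, hx'⟩ ⟨hy, hy'⟩
        refine ⟨G.domain.add_mem hx hy, ?_⟩
        have h := F.domain.add_mem hx' hy'
        rwa [← G.map_add] at h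
      zero_mem' := ⟨G.domain.zero_mem, by
        have h : G ⟨0, G.domain.zero_mem⟩ = 0 := G.map_zero
        rw [h]; exact F.domain.zero_mem⟩
      smul_mem' := by
        rintro c x ⟨hx, hx'⟩
        refine ⟨G.domain.smul_mem c hx, ?_⟩
        have h := F.domain.smul_mem c hx'
        rwa [← G.map_smul] at h }
  toFun :=
    { toFun := fun x => F ⟨G ⟨x, x.2.1⟩, x.2.2⟩
      map_add' := by
        rintro ⟨x, hx, hx'⟩ ⟨y, hy, hy'⟩
        rw [← F.map_add]
        congr 1
        exact Subtype.ext (G.map_add ⟨x, hx⟩ ⟨y, hy⟩)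
      map_smul' := by
        rintro c ⟨x, hx, hx'⟩
        rw [RingHom.id_apply, ← F.map_smul]
        congr 1
        exact Subtype.ext (G.map_smul c ⟨x, hx⟩) }

/-- The identity operator, defined on all of `X`. -/
def opId (X : Type*) [NormedAddCommGroup X] [NormedSpace ℂ X] : X →ₗ.[ℂ] X :=
  (LinearMap.id : X →ₗ[ℂ] X).toPMap ⊤

open Classical in
/-- The resolvent `R(μ, A) = (μ I - A)⁻¹ : X → D(A)`. It takes the value `0` when
`μ I - A : D(A) → X` is not bijective. For a closed operator on a Banach space bijectivity means
`μ ∈ ρ(A)`, since the inverse is then automatically bounded. -/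
def resolvent (A : X →ₗ.[ℂ] X) (μ : ℂ) : X →ₗ[ℂ] A.domain :=
  if h : Function.Bijective (μ • A.domain.subtype - A.toFun) then
    (LinearEquiv.ofBijective (μ • A.domain.subtype - A.toFun) h).symm
  else 0

/-- The Lambda extension `C_Λ x = lim_{λ → +∞} λ C R(λ, A) x` of an operator `C : D(A) → X`,
defined for all `x ∈ X` for which the limit exists. -/
def lambdaExt (A : X →ₗ.[ℂ] X) (C : A.domain →ₗ[ℂ] X) : X →ₗ.[ℂ] X :=
  strongLim (atTop : Filter ℝ) fun r => (r : ℂ) • C.comp (resolvent A (r : ℂ))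

end Operators

/-! ### Semigroups -/

/-- A `C₀`-semigroup of bounded operators on `X`. -/
structure C0Semigroup (X : Type*) [NormedAddCommGroup X] [NormedSpace ℂ X] where
  T : ℝ≥0 → X →L[ℂ] X
  map_zero : T 0 = 1
  map_add : ∀ s t, T (s + t) = T s * T t
  continuous_orbit : ∀ x, Continuous fun t => T t x

namespace C0Semigroup

variable {X : Type*} [NormedAddCommGroup X] [NormedSpace ℂ X] (S : C0Semigroup X)

/-- Exponential stability: `‖T(t)‖ ≤ M e^{ω t}` for some `M` and some `ω < 0`. -/
def ExpStable : Prop :=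
  ∃ M ω : ℝ, ω < 0 ∧ ∀ t : ℝ≥0, ‖S.T t‖ ≤ M * Real.exp (ω * t)

/-- The infinitesimal generator `A x = lim_{t → 0+} (T(t) x - x) / t`. -/
def generator : X →ₗ.[ℂ] X :=
  strongLim (𝓝[>] (0 : ℝ)) fun t =>
    ((t : ℂ)⁻¹) • ((S.T t.toNNReal : X →L[ℂ] X) - 1 : X →L[ℂ] X).toLinearMap

theorem mem_domain_T (t : ℝ≥0) {x : X} (hx : x ∈ S.generator.domain) :
    S.T t x ∈ S.generator.domain := by
  obtain ⟨z, hz⟩ := hx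
  refine ⟨S.T t z, ?_⟩
  have h := ((S.T t).continuous.tendsto z).comp hz
  refine h.congr fun s => ?_
  have hc : S.T t (S.T s.toNNReal x) = S.T s.toNNReal (S.T t x) := by
    have h1 := S.map_add t s.toNNReal
    rw [add_comm, S.map_add] at h1
    exact (DFunLike.congr_fun h1 x).symm
  simp [hc]

/-- `T(t) x` as an element of `D(A)`, for `x ∈ D(A)`. -/
def onDomain (t : ℝ≥0) (x : S.generator.domain) : S.generator.domain :=
  ⟨S.T t x, S.mem_domain_T t x.2⟩

end C0Semigroup

/-! ### The Toeplitz operator on `L²(0, ∞)` -/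

/-- `L²(0, ∞)`. -/
abbrev L2Pos : Type := Lp ℂ 2 (volume.restrict (Set.Ioi (0 : ℝ)))

/-- `L²` of the imaginary axis, parametrized by `s = 2 π i ξ` with `ξ ∈ ℝ`. -/
abbrev L2Line : Type := Lp ℂ 2 (volume : Measure ℝ)

theorem memLp_indicator (f : L2Pos) :
    MemLp ((Set.Ioi (0 : ℝ)).indicator (f : ℝ → ℂ)) 2 volume :=
  (memLp_indicator_iff_restrict measurableSet_Ioi).2 (Lp.memLp f)

/-- Extension by zero, `L²(0, ∞) → L²(ℝ)`. -/
def extendZero : L2Pos →ₗᵢ[ℂ] L2Line where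
  toFun f := (memLp_indicator f).toLp
  map_add' f g := by
    rw [← MemLp.toLp_add]
    refine (MemLp.toLp_eq_toLp_iff _ _).2 ?_
    have h := (ae_restrict_iff' measurableSet_Ioi).1 (Lp.coeFn_add f g)
    filter_upwards [h] with t ht
    by_cases h0 : t ∈ Set.Ioi (0 : ℝ)
    · simpa [Set.indicator_of_mem h0] using ht h0
    · simp [Set.indicator_of_notMem h0]
  map_smul' c f := by
    rw [RingHom.id_apply, ← MemLp.toLp_const_smul]
    refine (MemLp.toLp_eq_toLp_iff _ _).2 ?_
    have h := (ae_restrict_iff' measurableSet_Ioi).1 (Lp.coeFn_smul c f)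
    filter_upwards [h] with t ht
    by_cases h0 : t ∈ Set.Ioi (0 : ℝ)
    · simpa [Set.indicator_of_mem h0] using ht h0
    · simp [Set.indicator_of_notMem h0]
  norm_map' f := by
    change ‖(memLp_indicator f).toLp‖ = ‖f‖
    rw [Lp.norm_toLp, eLpNorm_indicator_eq_eLpNorm_restrict measurableSet_Ioi, Lp.norm_def]

/-- The Laplace transform `L²(0, ∞) → L²(iℝ)`, in terms of boundary values on the imaginary axis:
at `s = 2 π i ξ` it is the Fourier transform `∫₀^∞ e^{-2 π i ξ t} f(t) dt`. -/
def laplace : L2Pos →ₗᵢ[ℂ] L2Line :=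
  (Lp.fourierTransformₗᵢ ℝ ℂ).toLinearIsometry.comp extendZero

/-- The Hardy space `H²` of the right half-plane: the Laplace transforms of `L²(0, ∞)`. -/
def hardySpace : Submodule ℂ L2Line := LinearMap.range laplace.toLinearMap

instance : CompleteSpace hardySpace :=
  laplace.equivRange.toIsometryEquiv.completeSpace_iff.1 inferInstance

/-- The orthogonal projection `Π` of `L²(iℝ)` onto `H²`. -/
def hardyProj : L2Line →L[ℂ] hardySpace := hardySpace.orthogonalProjectionOnto

/-- The inverse Laplace transform `H² → L²(0, ∞)`. -/
def laplaceInv : hardySpace →ₗᵢ[ℂ] L2Pos := laplace.equivRange.symm.toLinearIsometry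

/-- `g` is bounded and holomorphic on the open left half-plane. Values of `g` elsewhere are
irrelevant. -/
def IsHInfty (g : ℂ → ℂ) : Prop :=
  DifferentiableOn ℂ g {z | z.re < 0} ∧ ∃ K : ℝ, ∀ z : ℂ, z.re < 0 → ‖g z‖ ≤ K

/-- The boundary function of `g`, that is `lim_{r → 0-} g(r + s)` at the point `s = 2 π i ξ` of the
imaginary axis. For bounded holomorphic `g` the limit exists for almost every `ξ`. -/
def boundary (g : ℂ → ℂ) (ξ : ℝ) : ℂ :=
  limUnder (𝓝[<] (0 : ℝ)) fun r => g ((r : ℂ) + 2 * Real.pi * ξ * Complex.I)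

open Classical in
/-- Multiplication `F ↦ g · F` on `L²(iℝ)` by the boundary function of `g`. (The product is again
in `L²` when `g` is bounded and holomorphic; otherwise the value is `0`.) -/
def boundaryMul (g : ℂ → ℂ) (F : L2Line) : L2Line :=
  if h : MemLp (fun ξ => boundary g ξ * F ξ) 2 volume then h.toLp else 0

/-- The Toeplitz operator `M_g f = 𝔏⁻¹ Π (g · 𝔏 f)` on `L²(0, ∞)`. -/
def toeplitz (g : ℂ → ℂ) (f : L2Pos) : L2Pos :=
  laplaceInv (hardyProj (boundaryMul g (laplace f)))

/-! ### The calculus -/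

section Calculus

variable {X : Type*} [NormedAddCommGroup X] [NormedSpace ℂ X]

theorem memLp_orbit (S : C0Semigroup X) (hS : S.ExpStable) (y : X →L[ℂ] ℂ) (x : X) :
    MemLp (fun t : ℝ => y (S.T t.toNNReal x)) 2 (volume.restrict (Set.Ioi (0 : ℝ))) := by
  obtain ⟨M, ω, hω, hM⟩ := hS
  have hc : Continuous fun t : ℝ => y (S.T t.toNNReal x) :=
    y.continuous.comp ((S.continuous_orbit x).comp continuous_real_toNNReal)
  have hexp : MemLp (fun t : ℝ => (‖y‖ * (M * ‖x‖)) * Real.exp (ω * t)) 2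
      (volume.restrict (Set.Ioi (0 : ℝ))) := by
    refine MemLp.const_mul ?_ _
    rw [memLp_two_iff_integrable_sq (by fun_prop)]
    have h : Integrable (fun t : ℝ => Real.exp ((2 * ω) * t))
        (volume.restrict (Set.Ioi (0 : ℝ))) := integrableOn_exp_mul_Ioi (by linarith) 0
    refine h.congr (Eventually.of_forall fun t => ?_)
    simp only
    rw [← Real.exp_nat_mul]
    congr 1
    push_cast
    ring
  refine hexp.mono hc.aestronglyMeasurable ?_
  filter_upwards [ae_restrict_mem measurableSet_Ioi] with t ht
  have ht' : ((t.toNNReal : ℝ≥0) : ℝ) = t := Real.coe_toNNReal t (le_of_lt ht)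
  have h1 : ‖S.T t.toNNReal x‖ ≤ M * Real.exp (ω * t) * ‖x‖ := by
    refine ((S.T t.toNNReal).le_opNorm x).trans ?_
    have := hM t.toNNReal
    rw [ht'] at this
    gcongr
  calc ‖y (S.T t.toNNReal x)‖ ≤ ‖y‖ * ‖S.T t.toNNReal x‖ := y.le_opNorm _
    _ ≤ ‖y‖ * (M * Real.exp (ω * t) * ‖x‖) := by gcongr
    _ = ‖y‖ * (M * ‖x‖) * Real.exp (ω * t) := by ring
    _ ≤ _ := Real.le_norm_self _

/-- The output mapping `𝔇_{g,y} x = M_g ⟨y, T(·) x⟩ ∈ L²(0, ∞)`. -/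
def outputMap (S : C0Semigroup X) (hS : S.ExpStable) (g : ℂ → ℂ) (y : X →L[ℂ] ℂ) (x : X) : L2Pos :=
  toeplitz g (memLp_orbit S hS y x).toLp

/-- `C` is bounded from `D(A)` with the graph norm to `X`, and
`𝔇_{g,y} x = ⟨y, C T(·) x⟩` in `L²(0, ∞)` for all `x ∈ D(A)` and `y ∈ X'`. -/
def IsCalculusOp (S : C0Semigroup X) (hS : S.ExpStable) (g : ℂ → ℂ)
    (C : S.generator.domain →ₗ[ℂ] X) : Prop :=
  (∃ K : ℝ, ∀ x : S.generator.domain, ‖C x‖ ≤ K * (‖(x : X)‖ + ‖S.generator x‖)) ∧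
  ∀ (y : X →L[ℂ] ℂ) (x : S.generator.domain),
    (outputMap S hS g y (x : X) : ℝ → ℂ) =ᵐ[volume.restrict (Set.Ioi (0 : ℝ))]
      fun t => y (C (S.onDomain t.toNNReal x))

open Classical in
/-- The operator `g(A) : D(A) → X`, that is the unique operator satisfying `IsCalculusOp`. -/
def calcOp (S : C0Semigroup X) (hS : S.ExpStable) (g : ℂ → ℂ) : S.generator.domain →ₗ[ℂ] X :=
  if h : ∃ C, IsCalculusOp S hS g C then h.choose else 0

/-- `g_Λ(A)`, the Lambda extension of `g(A)`. -/
def calcExt (S : C0Semigroup X) (hS : S.ExpStable) (g : ℂ → ℂ) : X →ₗ.[ℂ] X :=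
  lambdaExt S.generator (calcOp S hS g)

end Calculus

end WeakCalc

end

/-!
The proof rests on two properties of the Toeplitz operators `M_g`. They are multiplicative in `g`
(`toeplitz_mul_left`), because multiplication by a bounded holomorphic function on the left
half-plane preserves the orthogonal complement of `H²`
(`boundaryMul_mem_hardySpace_orthogonal`). And the symbol `e^{a s}` with `a ≥ 0` acts as the left
shift by `a` (`toeplitz_exp`), so that `M_g` commutes with left shifts.

The invariance of the complement of `H²` is tested on the functions `ε_a(t) = e^{-t} 1_{t > a}` and
their reflections, which are total by Lebesgue's differentiation theorem. For these, the claim is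
Cauchy's theorem `∫ g(i ω) (1 - i ω)⁻² dω = 0` (`IsHInfty.integral_boundary_div_sq`). The boundary
values exist by Fatou's theorem (`IsHInfty.ae_tendsto_boundary`): a primitive of `g` is Lipschitz,
hence differentiable at almost every point of the imaginary axis, and a Phragmén–Lindelöf argument
with Cauchy's estimate turns differentiability along the axis into convergence of `g`.

For the existence of `g(A)` put `κ = M_g† ε_0 ∈ L²(0, ∞)` and `B x = ∫₀^∞ conj κ(u) T(u) x du`, a
bounded operator with `⟨y, B x⟩ = ⟨ε_0, M_g ⟨y, T(·) x⟩⟩` that commutes with the semigroup. Then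
`g(A) x = B (x - A x)` for `x ∈ D(A)` (`exists_isCalculusOp`). Indeed, pairing `⟨y, g(A) T(·) x⟩`
with `ε_a` gives `e^{-a} ⟨y, B T(a) x⟩`, since `∫_a^∞ e^{-t} T(t) (x - A x) dt = e^{-a} T(a) x`, and
pairing `M_g ⟨y, T(·) x⟩` with `ε_a` gives the same value, by shift invariance
(`inner_expTail_outputMap`). In this form the integral that defines `B` converges in `X` itself, so
no reflexivity of `X` is needed.

The rules for the Lambda extensions follow from `(g₁ g₂)(A) R(r, A) x = g₁(A) R(r, A) g₂,Λ(A) x` for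
`x ∈ D(g₂,Λ(A))` (`calcOp_mul_resolvent`). It comes from multiplicativity of `M_g` when `x ∈ D(A)`,
and from replacing `x` by `μ R(μ, A) x` and letting `μ → ∞` in general.
-/

noncomputable section

namespace WeakCalc

/-! ### Boundary values of bounded holomorphic functions -/

/-- A holomorphic function on the left half-plane has a primitive: transport the statement to the
unit disc with the Cayley transform `z ↦ (1 + z) / (1 - z)`. -/
theorem exists_primitive_leftHalfPlane {g : ℂ → ℂ} (hg : DifferentiableOn ℂ g {z | z.re < 0}) :
    ∃ G : ℂ → ℂ, ∀ z : ℂ, z.re < 0 → HasDerivAt G (g z) z := by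
  have hw : ∀ w ∈ Metric.ball (0 : ℂ) 1, w + 1 ≠ 0 := by
    intro w hw h
    have : w = -1 := by linear_combination h
    simp [this] at hw
  have hmaps : ∀ w ∈ Metric.ball (0 : ℂ) 1, ((w - 1) / (w + 1)).re < 0 := by
    intro w hwb
    have h0 := hw w hwb
    have h1 : 0 < Complex.normSq (w + 1) := Complex.normSq_pos.2 h0
    have h2 : Complex.normSq w < 1 := by
      rw [Complex.normSq_eq_norm_sq]
      have : ‖w‖ < 1 := by simpa using hwb
      nlinarith [norm_nonneg w]
    rw [Complex.div_re, ← add_div]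
    refine div_neg_of_neg_of_pos ?_ h1
    simp [Complex.normSq_apply] at h2 ⊢
    nlinarith
  have hd : DifferentiableOn ℂ (fun w => g ((w - 1) / (w + 1)) * (2 / (w + 1) ^ 2))
      (Metric.ball (0 : ℂ) 1) := by
    refine DifferentiableOn.mul (hg.comp ?_ hmaps) ?_
    · exact DifferentiableOn.div (by fun_prop) (by fun_prop) hw
    · exact DifferentiableOn.div (by fun_prop) (by fun_prop) fun w h => pow_ne_zero 2 (hw w h)
  obtain ⟨P, hP⟩ := hd.isExactOn_ball
  refine ⟨fun z => P ((1 + z) / (1 - z)), fun z hz => ?_⟩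
  have h1 : (1 : ℂ) - z ≠ 0 := by
    intro h
    have : (1 - z).re = 0 := by rw [h]; rfl
    simp at this
    linarith
  have hmem : (1 + z) / (1 - z) ∈ Metric.ball (0 : ℂ) 1 := by
    rw [mem_ball_zero_iff, norm_div, div_lt_one (norm_pos_iff.2 h1)]
    rw [← sq_lt_sq₀ (norm_nonneg _) (norm_nonneg _), ← Complex.normSq_eq_norm_sq,
      ← Complex.normSq_eq_norm_sq]
    simp [Complex.normSq_apply]
    nlinarith
  have hc : HasDerivAt (fun z : ℂ => (1 + z) / (1 - z))
      ((1 * (1 - z) - (1 + z) * (-1)) / (1 - z) ^ 2) z :=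
    ((hasDerivAt_id z).const_add 1).div ((hasDerivAt_id z).const_sub 1) h1
  have h := (hP _ hmem).comp z hc
  have h2 : ((1 + z) / (1 - z) - 1) / ((1 + z) / (1 - z) + 1) = z := by
    field_simp
    ring
  have h3 : (1 + z) / (1 - z) + 1 = 2 / (1 - z) := by
    field_simp
    ring
  refine h.congr_deriv ?_
  beta_reduce
  rw [h2, h3]
  field_simp
  ring

/-- If `E` is Lipschitz at a point `z₀` of the imaginary axis, holomorphic to the left of the axis,
and `E (z) = o (z - z₀)` along the axis, then also `E (z) = o (z - z₀)` in the whole left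
half-plane. The substitution `z = z₀ - e^w` turns the half-plane into a strip and moves `z₀` to
infinity, so that the Phragmén–Lindelöf principle applies to `E (z) / (z - z₀)`, multiplied by a
factor that is small on the part of the axis far from `z₀`. -/
theorem eventually_norm_le_of_axis {E : ℂ → ℂ} {ω₀ C : ℝ} (hcont : Continuous E)
    (hE : DifferentiableOn ℂ E {z | z.re < 0})
    (hC : ∀ z, ‖E z‖ ≤ C * ‖z - ω₀ * Complex.I‖)
    (ho : (fun ω : ℝ => E (ω * Complex.I)) =o[𝓝 ω₀] fun ω => ω - ω₀) {ε : ℝ} (hε : 0 < ε) :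
    ∃ η > 0, ∀ z : ℂ, z.re < 0 → ‖z - ω₀ * Complex.I‖ ≤ η →
      ‖E z‖ ≤ 2 * ε * ‖z - ω₀ * Complex.I‖ := by
  set z₀ : ℂ := ω₀ * Complex.I with hz₀
  have hC0 : 0 ≤ C := by
    have := (norm_nonneg _).trans (hC (z₀ + 1))
    simpa using this
  obtain ⟨δ, hδ, hball⟩ := Metric.eventually_nhds_iff.1 (ho.bound hε)
  -- `η` makes the damping factor `η / (η - (z - z₀))` at most `ε / C` at distance `δ` from `z₀`
  set η : ℝ := ε * δ / (C + 1) with hη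
  have hη0 : 0 < η := by positivity
  have hηC : C * η ≤ ε * δ := by
    rw [hη, mul_div_assoc', div_le_iff₀ (by positivity)]
    nlinarith [mul_pos hε hδ]
  refine ⟨η, hη0, fun z hz hzη => ?_⟩
  set f : ℂ → ℂ := fun w => E (z₀ - Complex.exp w) / (-Complex.exp w) *
    (η / (η + Complex.exp w)) with hf
  have hexp : ∀ w : ℂ, |w.im| ≤ Real.pi / 2 → 0 ≤ (Complex.exp w).re := by
    intro w hw
    rw [Complex.exp_re]
    exact mul_nonneg (Real.exp_pos _).le (Real.cos_nonneg_of_mem_Icc ⟨by linarith [(abs_le.1 hw).1],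
      (abs_le.1 hw).2⟩)
  have hne : ∀ w : ℂ, |w.im| ≤ Real.pi / 2 → (η : ℂ) + Complex.exp w ≠ 0 := by
    intro w hw h
    have h1 := hexp w hw
    have : ((η : ℂ) + Complex.exp w).re = 0 := by rw [h]; rfl
    simp only [Complex.add_re, Complex.ofReal_re] at this
    linarith
  have hfactor : ∀ w : ℂ, |w.im| ≤ Real.pi / 2 → ‖(η : ℂ) / (η + Complex.exp w)‖ ≤ 1 := by
    intro w hw
    rw [norm_div, div_le_one (norm_pos_iff.2 (hne w hw))]
    have h1 := Complex.re_le_norm ((η : ℂ) + Complex.exp w)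
    simp only [Complex.add_re, Complex.ofReal_re] at h1
    rw [Complex.norm_real, Real.norm_of_nonneg hη0.le]
    linarith [hexp w hw]
  have hquot : ∀ w : ℂ, ‖E (z₀ - Complex.exp w) / (-Complex.exp w)‖ ≤ C := by
    intro w
    rw [norm_div, norm_neg, div_le_iff₀ (norm_pos_iff.2 (Complex.exp_ne_zero w))]
    simpa using hC (z₀ - Complex.exp w)
  have hbd : ∀ w : ℂ, |w.im| ≤ Real.pi / 2 → ‖f w‖ ≤ C := by
    intro w hw
    rw [hf]
    simp only [norm_mul]
    calc _ ≤ C * 1 := mul_le_mul (hquot w) (hfactor w hw) (norm_nonneg _) hC0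
      _ = C := mul_one C
  have hside : ∀ w : ℂ, |w.im| = Real.pi / 2 → ‖f w‖ ≤ ε := by
    intro w hw
    obtain ⟨σ, hσ, hσw⟩ : ∃ σ : ℝ, |σ| = Real.exp w.re ∧ Complex.exp w = σ * Complex.I := by
      rcases (abs_eq (by positivity)).1 hw with h | h
      · refine ⟨Real.exp w.re, abs_of_pos (Real.exp_pos _), ?_⟩
        rw [← Complex.re_add_im w, Complex.exp_add, h]
        simp [Complex.exp_mul_I]
      · refine ⟨-Real.exp w.re, by rw [abs_neg, abs_of_pos (Real.exp_pos _)], ?_⟩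
        rw [← Complex.re_add_im w, Complex.exp_add, h]
        simp [Complex.exp_neg, Complex.exp_mul_I]
    have hσ0 : 0 < |σ| := by rw [hσ]; exact Real.exp_pos _
    rcases lt_or_ge |σ| δ with h | h
    · have h1 := @hball (ω₀ - σ) (by simp [h])
      have h2 : E (z₀ - Complex.exp w) = E (((ω₀ - σ : ℝ) : ℂ) * Complex.I) := by
        rw [hσw, hz₀]; push_cast; ring_nf
      have h3 : ‖E (z₀ - Complex.exp w) / (-Complex.exp w)‖ ≤ ε := by
        rw [norm_div, h2, div_le_iff₀ (by simp)]
        refine h1.trans (le_of_eq ?_)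
        rw [norm_neg, hσw]
        simp
      rw [hf]
      simp only [norm_mul]
      calc _ ≤ ε * 1 := mul_le_mul h3 (hfactor w hw.le) (norm_nonneg _) hε.le
        _ = ε := mul_one ε
    · have h1 : ‖(η : ℂ) / (η + Complex.exp w)‖ ≤ η / δ := by
        rw [norm_div, Complex.norm_real, Real.norm_of_nonneg hη0.le]
        refine div_le_div_of_nonneg_left hη0.le hδ (h.trans ?_)
        have := Complex.abs_im_le_norm ((η : ℂ) + Complex.exp w)
        rw [hσw] at this ⊢
        simpa using this
      rw [hf]
      simp only [norm_mul]
      calc _ ≤ C * (η / δ) := mul_le_mul (hquot w) h1 (norm_nonneg _) hC0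
        _ ≤ ε := by
          rw [mul_div_assoc', div_le_iff₀ hδ]
          exact hηC
  have hstrip : ∀ w : ℂ, w ∈ Complex.im ⁻¹' Set.Ioo (-(Real.pi / 2)) (Real.pi / 2) →
      |w.im| < Real.pi / 2 := fun w hw => abs_lt.2 hw
  have hclos : ∀ w : ℂ, w ∈ closure (Complex.im ⁻¹' Set.Ioo (-(Real.pi / 2)) (Real.pi / 2)) →
      |w.im| ≤ Real.pi / 2 := by
    intro w hw
    rw [Complex.closure_preimage_im, closure_Ioo (by linarith [Real.pi_pos])] at hw
    exact abs_le.2 hw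
  have hdiff : DiffContOnCl ℂ f (Complex.im ⁻¹' Set.Ioo (-(Real.pi / 2)) (Real.pi / 2)) := by
    constructor
    · refine DifferentiableOn.mul (DifferentiableOn.div (hE.comp (by fun_prop) ?_) (by fun_prop) ?_)
        (DifferentiableOn.div (by fun_prop) (by fun_prop) ?_)
      · intro w hw
        have h1 := hstrip w hw
        have : 0 < (Complex.exp w).re := by
          rw [Complex.exp_re]
          exact mul_pos (Real.exp_pos _) (Real.cos_pos_of_mem_Ioo (abs_lt.1 h1))
        simpa [hz₀] using this
      · exact fun w _ => neg_ne_zero.2 (Complex.exp_ne_zero w)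
      · exact fun w hw => hne w (hstrip w hw).le
    · refine ContinuousOn.mul (ContinuousOn.div (by fun_prop) (by fun_prop) ?_)
        (ContinuousOn.div (by fun_prop) (by fun_prop) ?_)
      · exact fun w _ => neg_ne_zero.2 (Complex.exp_ne_zero w)
      · exact fun w hw => hne w (hclos w hw)
  have hzne : z₀ - z ≠ 0 := by
    intro h
    have : (z₀ - z).re = 0 := by rw [h]; rfl
    simp [hz₀] at this
    linarith
  have hlog : |(Complex.log (z₀ - z)).im| ≤ Real.pi / 2 := by
    rw [Complex.log_im, Complex.abs_arg_le_pi_div_two_iff]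
    simp [hz₀, hz.le]
  have hpl : ‖f (Complex.log (z₀ - z))‖ ≤ ε := by
    refine PhragmenLindelof.horizontal_strip hdiff ⟨0, ?_, 0, ?_⟩ ?_ ?_ (abs_le.1 hlog).1
      (abs_le.1 hlog).2
    · have : 0 < Real.pi / 2 - -(Real.pi / 2) := by linarith [Real.pi_pos]
      positivity
    · refine Asymptotics.IsBigO.of_bound C ?_
      filter_upwards [mem_inf_of_right (mem_principal_self _)] with w hw
      simpa using hbd w (hstrip w hw).le
    · exact fun w hw => hside w (by rw [hw, abs_neg, abs_of_pos (by positivity)])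
    · exact fun w hw => hside w (by rw [hw, abs_of_pos (by positivity)])
  rw [hf] at hpl
  simp only [Complex.exp_log hzne, sub_sub_cancel, norm_mul, norm_div, norm_neg, Complex.norm_real,
    Real.norm_of_nonneg hη0.le] at hpl
  have hpos : 0 < ‖z₀ - z‖ := norm_pos_iff.2 hzne
  have hden : 0 < ‖(η : ℂ) + (z₀ - z)‖ := by
    have := hne _ hlog
    rw [Complex.exp_log hzne] at this
    exact norm_pos_iff.2 this
  have hden2 : ‖(η : ℂ) + (z₀ - z)‖ ≤ 2 * η := by
    refine (norm_add_le _ _).trans ?_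
    rw [Complex.norm_real, Real.norm_of_nonneg hη0.le, norm_sub_rev]
    linarith
  rw [div_mul_div_comm, div_le_iff₀ (mul_pos hpos hden)] at hpl
  rw [norm_sub_rev z z₀]
  have h1 : ‖E z‖ * η ≤ 2 * ε * ‖z₀ - z‖ * η := by
    calc ‖E z‖ * η ≤ ε * (‖z₀ - z‖ * ‖(η : ℂ) + (z₀ - z)‖) := hpl
      _ ≤ ε * (‖z₀ - z‖ * (2 * η)) := by gcongr
      _ = _ := by ring
  exact le_of_mul_le_mul_right h1 hη0

/-- **Fatou's theorem** for horizontal limits. The primitive of `g` is Lipschitz, hence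
differentiable almost everywhere along the imaginary axis, and `g` converges at such points. -/
theorem IsHInfty.ae_tendsto_boundary {g : ℂ → ℂ} (hg : IsHInfty g) :
    ∀ᵐ ξ : ℝ, Tendsto (fun r : ℝ => g ((r : ℂ) + 2 * Real.pi * ξ * Complex.I)) (𝓝[<] 0)
      (𝓝 (boundary g ξ)) := by
  obtain ⟨hd, K, hK⟩ := hg
  obtain ⟨G, hG⟩ := exists_primitive_leftHalfPlane hd
  have hopen : IsOpen {z : ℂ | z.re < 0} := isOpen_lt Complex.continuous_re continuous_const
  have hconv : Convex ℝ {z : ℂ | z.re < 0} := convex_halfSpace_re_lt 0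
  have hlip : LipschitzOnWith K.toNNReal G {z : ℂ | z.re < 0} := by
    refine hconv.lipschitzOnWith_of_nnnorm_hasDerivWithin_le
      (fun z hz => (hG z hz).hasDerivWithinAt) fun z hz => ?_
    rw [← NNReal.coe_le_coe, coe_nnnorm]
    exact (hK z hz).trans (Real.le_coe_toNNReal K)
  obtain ⟨F, hF, hFG⟩ := hlip.extend_finite_dimension
  set L := lipschitzExtensionConstant ℂ * K.toNNReal with hL
  have hFd : ∀ z : ℂ, z.re < 0 → HasDerivAt F (g z) z := fun z hz =>
    (hG z hz).congr_of_eventuallyEq (hFG.symm.eventuallyEq_of_mem (hopen.mem_nhds hz))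
  have hlin : LipschitzWith (Real.toNNReal (2 * Real.pi)) fun ξ : ℝ =>
      (2 * Real.pi * ξ * Complex.I : ℂ) := by
    refine LipschitzWith.of_dist_le_mul fun x y => ?_
    rw [Real.coe_toNNReal _ (by positivity), dist_eq_norm, dist_eq_norm]
    have : (2 * Real.pi * x * Complex.I - 2 * Real.pi * y * Complex.I : ℂ)
        = ((2 * Real.pi : ℝ) : ℂ) * ((x - y : ℝ) : ℂ) * Complex.I := by push_cast; ring
    rw [this, norm_mul, norm_mul, Complex.norm_real, Complex.norm_real, Complex.norm_I, mul_one,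
      Real.norm_of_nonneg (by positivity : (0 : ℝ) ≤ 2 * Real.pi)]
  filter_upwards [(hF.comp hlin).ae_differentiableAt_real] with ξ hξ
  set ω₀ : ℝ := 2 * Real.pi * ξ with hω₀
  have hax : DifferentiableAt ℝ (fun ω : ℝ => F (ω * Complex.I)) ω₀ := by
    have h1 : (fun ω : ℝ => F (ω * Complex.I)) =
        (F ∘ fun ξ : ℝ => (2 * Real.pi * ξ * Complex.I : ℂ)) ∘ fun ω : ℝ => ω / (2 * Real.pi) := by
      funext ω
      simp only [Function.comp]
      congr 1
      push_cast
      field_simp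
    rw [h1]
    refine DifferentiableAt.comp _ ?_ (by fun_prop)
    have : ω₀ / (2 * Real.pi) = ξ := by rw [hω₀]; field_simp
    rwa [this]
  -- `α` is the derivative of `F` at `z₀` as computed along the axis; it will be the limit of `g`
  set α : ℂ := deriv (fun ω : ℝ => F (ω * Complex.I)) ω₀ / Complex.I with hα
  set z₀ : ℂ := ω₀ * Complex.I with hz₀
  set E : ℂ → ℂ := fun z => F z - F z₀ - (z - z₀) * α with hE
  have hEd : ∀ z : ℂ, z.re < 0 → HasDerivAt E (g z - α) z := fun z hz =>
    (((hFd z hz).sub_const (F z₀)).sub (((hasDerivAt_id z).sub_const z₀).mul_const α)).congr_deriv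
      (by simp)
  have hEc : ∀ z, ‖E z‖ ≤ (L + ‖α‖) * ‖z - z₀‖ := by
    intro z
    calc ‖E z‖ ≤ ‖F z - F z₀‖ + ‖(z - z₀) * α‖ := norm_sub_le _ _
      _ ≤ L * ‖z - z₀‖ + ‖z - z₀‖ * ‖α‖ := by
        rw [norm_mul]
        gcongr
        simpa [dist_eq_norm] using hF.dist_le_mul z z₀
      _ = _ := by ring
  have ho : (fun ω : ℝ => E (ω * Complex.I)) =o[𝓝 ω₀] fun ω => ω - ω₀ := by
    refine (hasDerivAt_iff_isLittleO.1 hax.hasDerivAt).congr_left fun ω => ?_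
    simp only [hE, hz₀, hα, Complex.real_smul]
    push_cast
    field_simp
  refine tendsto_nhds_limUnder ⟨α, ?_⟩
  rw [Metric.tendsto_nhdsWithin_nhds]
  intro ε hε
  obtain ⟨η, hη, h⟩ := eventually_norm_le_of_axis (C := L + ‖α‖)
    ((hF.continuous.sub continuous_const).sub ((continuous_id.sub continuous_const).mul_const α))
    (fun z hz => (hEd z hz).differentiableAt.differentiableWithinAt) hEc ho
    (show 0 < ε / 7 by positivity)
  refine ⟨η / 2, by positivity, fun {r} hr hrη => ?_⟩
  have hr : r < 0 := hr
  rw [dist_eq_norm, sub_zero, Real.norm_eq_abs, abs_of_neg hr] at hrη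
  set z : ℂ := (r : ℂ) + 2 * Real.pi * ξ * Complex.I with hz
  have hzz : z = r + z₀ := by rw [hz, hz₀, hω₀]; push_cast; ring
  have hzre : z.re = r := by rw [hzz, hz₀]; simp
  have hballre : ∀ w ∈ Metric.closedBall z (-r / 2), w.re < 0 := by
    intro w hw
    have h1 : |(w - z).re| ≤ -r / 2 := (Complex.abs_re_le_norm _).trans (by
      simpa [dist_eq_norm] using hw)
    rw [Complex.sub_re, hzre] at h1
    linarith [(abs_le.1 h1).2]
  -- Cauchy's estimate on the disc of radius `|r| / 2`, which stays in the half-plane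
  have hder : ‖deriv E z‖ ≤ (2 * (ε / 7) * (-(3 / 2) * r)) / (-r / 2) := by
    refine Complex.norm_deriv_le_of_forall_mem_sphere_norm_le (by linarith) ?_ fun w hw => ?_
    · refine DifferentiableOn.diffContOnCl fun w hw => ?_
      rw [closure_ball _ (by linarith : -r / 2 ≠ 0)] at hw
      exact (hEd w (hballre w hw)).differentiableAt.differentiableWithinAt
    · have hwz : ‖w - z₀‖ ≤ -(3 / 2) * r := by
        calc ‖w - z₀‖ = ‖(w - z) + r‖ := by rw [hzz]; ring_nf
          _ ≤ ‖w - z‖ + ‖(r : ℂ)‖ := norm_add_le _ _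
          _ = -(3 / 2) * r := by
            rw [Complex.norm_real, Real.norm_eq_abs, abs_of_neg hr, ← dist_eq_norm,
              Metric.mem_sphere.1 hw]
            ring
      refine (h w (hballre w (Metric.sphere_subset_closedBall hw)) (by linarith)).trans ?_
      gcongr
  rw [(hEd z (by rw [hzre]; exact hr)).deriv] at hder
  rw [dist_eq_norm]
  refine hder.trans_lt ?_
  have : 2 * (ε / 7) * (-(3 / 2) * r) / (-r / 2) = 6 / 7 * ε := by
    have := hr.ne
    field_simp
    ring
  rw [this]
  linarith

/-! ### The algebra of boundary functions -/

theorem IsHInfty.exists_bound {g : ℂ → ℂ} (hg : IsHInfty g) :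
    ∃ K : ℝ, 0 ≤ K ∧ ∀ z : ℂ, z.re < 0 → ‖g z‖ ≤ K := by
  obtain ⟨-, K, hK⟩ := hg
  exact ⟨K, (norm_nonneg _).trans (hK (-1) (by simp)), hK⟩

theorem IsHInfty.add {g₁ g₂ : ℂ → ℂ} (h₁ : IsHInfty g₁) (h₂ : IsHInfty g₂) :
    IsHInfty (g₁ + g₂) := by
  obtain ⟨K₁, -, hK₁⟩ := h₁.exists_bound
  obtain ⟨K₂, -, hK₂⟩ := h₂.exists_bound
  exact ⟨h₁.1.add h₂.1, K₁ + K₂, fun z hz =>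
    (norm_add_le _ _).trans (add_le_add (hK₁ z hz) (hK₂ z hz))⟩

theorem IsHInfty.mul {g₁ g₂ : ℂ → ℂ} (h₁ : IsHInfty g₁) (h₂ : IsHInfty g₂) :
    IsHInfty (g₁ * g₂) := by
  obtain ⟨K₁, h0, hK₁⟩ := h₁.exists_bound
  obtain ⟨K₂, -, hK₂⟩ := h₂.exists_bound
  refine ⟨h₁.1.mul h₂.1, K₁ * K₂, fun z hz => ?_⟩
  rw [Pi.mul_apply, norm_mul]
  exact mul_le_mul (hK₁ z hz) (hK₂ z hz) (norm_nonneg _) h0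

theorem isHInfty_exp {a : ℝ} (ha : 0 ≤ a) : IsHInfty fun z => Complex.exp (a * z) := by
  refine ⟨by fun_prop, 1, fun z hz => ?_⟩
  rw [Complex.norm_exp, Real.exp_le_one_iff]
  simpa using mul_nonpos_of_nonneg_of_nonpos ha hz.le

theorem boundary_eq_of_continuous {g : ℂ → ℂ} (hg : Continuous g) (ξ : ℝ) :
    boundary g ξ = g (2 * Real.pi * ξ * Complex.I) := by
  refine Tendsto.limUnder_eq (Tendsto.mono_left ?_ nhdsWithin_le_nhds)
  have h : Continuous fun r : ℝ => g ((r : ℂ) + 2 * Real.pi * ξ * Complex.I) := by fun_prop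
  simpa using h.tendsto 0

theorem boundary_eq_one {g : ℂ → ℂ} (hg : ∀ z : ℂ, z.re < 0 → g z = 1) (ξ : ℝ) :
    boundary g ξ = 1 := by
  refine Tendsto.limUnder_eq (tendsto_const_nhds.congr' ?_)
  filter_upwards [self_mem_nhdsWithin] with r hr
  exact (hg _ (by simpa using hr)).symm

theorem IsHInfty.ae_norm_boundary_le {g : ℂ → ℂ} (hg : IsHInfty g) {K : ℝ}
    (hK : ∀ z : ℂ, z.re < 0 → ‖g z‖ ≤ K) : ∀ᵐ ξ : ℝ, ‖boundary g ξ‖ ≤ K := by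
  filter_upwards [hg.ae_tendsto_boundary] with ξ hξ
  refine le_of_tendsto hξ.norm ?_
  filter_upwards [self_mem_nhdsWithin] with r hr
  exact hK _ (by simpa using hr)

theorem continuous_vertical {g : ℂ → ℂ} (hg : DifferentiableOn ℂ g {z | z.re < 0}) {r : ℝ}
    (hr : r < 0) : Continuous fun ξ : ℝ => g ((r : ℂ) + 2 * Real.pi * ξ * Complex.I) :=
  hg.continuousOn.comp_continuous (by fun_prop) fun ξ => by simpa using hr

theorem IsHInfty.aestronglyMeasurable_boundary {g : ℂ → ℂ} (hg : IsHInfty g) :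
    AEStronglyMeasurable (boundary g) volume := by
  have hu : Tendsto (fun n : ℕ => -(1 / ((n : ℝ) + 1))) atTop (𝓝[<] 0) := by
    refine tendsto_nhdsWithin_iff.2 ⟨?_, Eventually.of_forall fun n => ?_⟩
    · simpa using (tendsto_one_div_add_atTop_nhds_zero_nat (𝕜 := ℝ)).neg
    · simp only [Set.mem_Iio, Left.neg_neg_iff]
      positivity
  refine aestronglyMeasurable_of_tendsto_ae (u := atTop) (f := fun (n : ℕ) (ξ : ℝ) =>
    g (((-(1 / ((n : ℝ) + 1)) : ℝ) : ℂ) + 2 * Real.pi * ξ * Complex.I)) (fun n => ?_) ?_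
  · refine (continuous_vertical hg.1 ?_).aestronglyMeasurable
    simp only [Left.neg_neg_iff]
    positivity
  · filter_upwards [hg.ae_tendsto_boundary] with ξ hξ
    exact hξ.comp hu

theorem boundary_add_ae {g₁ g₂ : ℂ → ℂ} (h₁ : IsHInfty g₁) (h₂ : IsHInfty g₂) :
    boundary (g₁ + g₂) =ᵐ[volume] fun ξ => boundary g₁ ξ + boundary g₂ ξ := by
  filter_upwards [h₁.ae_tendsto_boundary, h₂.ae_tendsto_boundary] with ξ hξ₁ hξ₂
  exact (hξ₁.add hξ₂).limUnder_eq

theorem boundary_mul_ae {g₁ g₂ : ℂ → ℂ} (h₁ : IsHInfty g₁) (h₂ : IsHInfty g₂) :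
    boundary (g₁ * g₂) =ᵐ[volume] fun ξ => boundary g₁ ξ * boundary g₂ ξ := by
  filter_upwards [h₁.ae_tendsto_boundary, h₂.ae_tendsto_boundary] with ξ hξ₁ hξ₂
  exact (hξ₁.mul hξ₂).limUnder_eq

/-- The integrals of a holomorphic function with quadratic decay along two vertical lines in the
left half-plane agree. -/
theorem integral_vertical_eq {Φ : ℂ → ℂ} (hΦ : DifferentiableOn ℂ Φ {z | z.re < 0}) {K : ℝ}
    (hK : ∀ z : ℂ, z.re < 0 → ‖Φ z‖ ≤ K * (1 + z.im ^ 2)⁻¹) {r s : ℝ} (hr : r < 0) (hs : s < 0) :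
    ∫ y : ℝ, Φ (r + y * Complex.I) = ∫ y : ℝ, Φ (s + y * Complex.I) := by
  have hint : ∀ r : ℝ, r < 0 → Integrable fun y : ℝ => Φ (r + y * Complex.I) := by
    intro r hr
    refine (integrable_inv_one_add_sq.const_mul K).mono' ?_ (Eventually.of_forall fun y => ?_)
    · exact (hΦ.continuousOn.comp_continuous (by fun_prop)
        fun y => by simpa using hr).aestronglyMeasurable
    · simpa using hK (r + y * Complex.I) (by simpa using hr)
  have hlim : ∀ r : ℝ, r < 0 → Tendsto (fun R : ℝ => ∫ y in (-R)..R, Φ (r + y * Complex.I)) atTop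
      (𝓝 (∫ y : ℝ, Φ (r + y * Complex.I))) := fun r hr =>
    intervalIntegral_tendsto_integral (hint r hr) tendsto_neg_atTop_atBot tendsto_id
  have hside : ∀ σ : ℝ, σ ^ 2 = 1 →
      Tendsto (fun R : ℝ => ∫ x in r..s, Φ (x + (σ * R : ℝ) * Complex.I)) atTop (𝓝 0) := by
    intro σ hσ
    have hb : Tendsto (fun R : ℝ => K * (1 + R ^ 2)⁻¹ * |s - r|) atTop (𝓝 0) := by
      have : Tendsto (fun R : ℝ => (1 + R ^ 2)⁻¹) atTop (𝓝 0) :=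
        tendsto_inv_atTop_zero.comp (tendsto_atTop_add_const_left _ _
          (tendsto_pow_atTop two_ne_zero))
      simpa using (this.const_mul K).mul_const |s - r|
    refine squeeze_zero_norm (fun R => ?_) hb
    refine intervalIntegral.norm_integral_le_of_norm_le_const fun x hx => ?_
    have hx0 : x < 0 := lt_of_le_of_lt hx.2 (max_lt hr hs)
    refine (hK _ (by simpa using hx0)).trans (le_of_eq ?_)
    simp [mul_pow, hσ]
  have hrect : ∀ R : ℝ, (∫ x in r..s, Φ (x + ((-1) * R : ℝ) * Complex.I)) -
      (∫ x in r..s, Φ (x + (1 * R : ℝ) * Complex.I)) +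
      Complex.I • (∫ y in (-R)..R, Φ (s + y * Complex.I)) -
      Complex.I • (∫ y in (-R)..R, Φ (r + y * Complex.I)) = 0 := by
    intro R
    have h := Complex.integral_boundary_rect_eq_zero_of_differentiableOn Φ ⟨r, -R⟩ ⟨s, R⟩
      (hΦ.mono fun z hz => ?_)
    · simpa using h
    · have h1 : z.re ∈ Set.uIcc r s := hz.1
      exact lt_of_le_of_lt h1.2 (max_lt hr hs)
  have h := (((hside (-1) (by norm_num)).sub (hside 1 (by norm_num))).add
    ((hlim s hs).const_smul Complex.I)).sub ((hlim r hr).const_smul Complex.I)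
  simp only [hrect] at h
  have h0 := tendsto_nhds_unique h tendsto_const_nhds
  rw [sub_self, zero_add, sub_eq_zero] at h0
  exact (smul_right_injective ℂ Complex.I_ne_zero h0).symm

/-- Cauchy's theorem on the closed half-plane, in terms of boundary values: shift the line of
integration to `-∞`. -/
theorem IsHInfty.integral_boundary_div_sq {g : ℂ → ℂ} (hg : IsHInfty g) :
    ∫ ξ : ℝ, boundary g ξ / (1 - 2 * Real.pi * ξ * Complex.I) ^ 2 = 0 := by
  obtain ⟨K, hK0, hK⟩ := hg.exists_bound
  set Φ : ℂ → ℂ := fun z => g z / (1 - z) ^ 2 with hΦdef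
  have hne : ∀ z : ℂ, z.re < 0 → (1 : ℂ) - z ≠ 0 := by
    intro z hz h
    have : ((1 : ℂ) - z).re = 0 := by rw [h]; rfl
    simp at this
    linarith
  have hΦ : DifferentiableOn ℂ Φ {z | z.re < 0} :=
    hg.1.div (by fun_prop) fun z hz => pow_ne_zero 2 (hne z hz)
  have hnorm : ∀ z : ℂ, ‖(1 - z) ^ 2‖ = (1 - z.re) ^ 2 + z.im ^ 2 := by
    intro z
    rw [norm_pow, ← Complex.normSq_eq_norm_sq, Complex.normSq_apply]
    simp
    ring
  have hb : ∀ z : ℂ, z.re < 0 → ‖Φ z‖ ≤ K * (1 + z.im ^ 2)⁻¹ := by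
    intro z hz
    rw [hΦdef]
    simp only
    rw [norm_div, hnorm, div_eq_mul_inv]
    have : 1 + z.im ^ 2 ≤ (1 - z.re) ^ 2 + z.im ^ 2 := by nlinarith
    have := hK z hz
    gcongr
  have hb' : ∀ z : ℂ, z.re < 0 → ‖Φ z‖ ≤ K * (1 - z.re)⁻¹ := by
    intro z hz
    rw [hΦdef]
    simp only
    rw [norm_div, hnorm, div_eq_mul_inv]
    have : 1 - z.re ≤ (1 - z.re) ^ 2 + z.im ^ 2 := by nlinarith [sq_nonneg z.im]
    have h1 := hK z hz
    have h2 : 0 < 1 - z.re := by linarith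
    gcongr
  have hzero : ∀ r : ℝ, r < 0 → ∫ y : ℝ, Φ (r + y * Complex.I) = 0 := by
    intro r hr
    have hlim : Tendsto (fun s : ℝ => ∫ y : ℝ, Φ (s + y * Complex.I)) atBot (𝓝 (∫ _ : ℝ, 0)) := by
      refine tendsto_integral_filter_of_dominated_convergence (fun y => K * (1 + y ^ 2)⁻¹) ?_ ?_
        (integrable_inv_one_add_sq.const_mul K) (Eventually.of_forall fun y => ?_)
      · filter_upwards [eventually_lt_atBot 0] with s hs
        exact (hΦ.continuousOn.comp_continuous (by fun_prop)
          fun y => by simpa using hs).aestronglyMeasurable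
      · filter_upwards [eventually_lt_atBot 0] with s hs
        exact Eventually.of_forall fun y => by simpa using hb (s + y * Complex.I) (by simpa using hs)
      · have h1 : Tendsto (fun s : ℝ => K * (1 - s)⁻¹) atBot (𝓝 0) := by
          have : Tendsto (fun s : ℝ => 1 - s) atBot atTop :=
            tendsto_atTop_add_const_left _ _ tendsto_neg_atBot_atTop
          simpa using (tendsto_inv_atTop_zero.comp this).const_mul K
        refine squeeze_zero_norm' ?_ h1
        filter_upwards [eventually_lt_atBot 0] with s hs
        simpa using hb' (s + y * Complex.I) (by simpa using hs)
    rw [integral_zero] at hlim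
    refine tendsto_nhds_unique (tendsto_const_nhds.congr' ?_) hlim
    filter_upwards [eventually_lt_atBot 0] with s hs
    exact integral_vertical_eq hΦ hb hr hs
  have hzero' : ∀ r : ℝ, r < 0 →
      ∫ ξ : ℝ, Φ ((r : ℂ) + 2 * Real.pi * ξ * Complex.I) = 0 := by
    intro r hr
    have h := Measure.integral_comp_mul_left (fun y : ℝ => Φ (r + y * Complex.I)) (2 * Real.pi)
    rw [hzero r hr, smul_zero] at h
    rw [← h]
    simp
  have hlim : Tendsto (fun r : ℝ => ∫ ξ : ℝ, Φ ((r : ℂ) + 2 * Real.pi * ξ * Complex.I)) (𝓝[<] 0)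
      (𝓝 (∫ ξ : ℝ, boundary g ξ / (1 - 2 * Real.pi * ξ * Complex.I) ^ 2)) := by
    refine tendsto_integral_filter_of_dominated_convergence
      (fun ξ => K * (1 + (2 * Real.pi * ξ) ^ 2)⁻¹) ?_ ?_ ?_ ?_
    · filter_upwards [self_mem_nhdsWithin] with r hr
      exact (continuous_vertical hΦ hr).aestronglyMeasurable
    · filter_upwards [self_mem_nhdsWithin] with r hr
      refine Eventually.of_forall fun ξ => ?_
      simpa using hb ((r : ℂ) + 2 * Real.pi * ξ * Complex.I) (by simpa using hr)
    · exact (integrable_inv_one_add_sq.comp_mul_left' (by positivity)).const_mul K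
    · filter_upwards [hg.ae_tendsto_boundary] with ξ hξ
      refine hξ.div ?_ ?_
      · have h : Continuous fun r : ℝ => (1 - ((r : ℂ) + 2 * Real.pi * ξ * Complex.I)) ^ 2 := by
          fun_prop
        simpa using (h.tendsto 0).mono_left nhdsWithin_le_nhds
      · refine pow_ne_zero 2 fun h => ?_
        have : ((1 : ℂ) - 2 * Real.pi * ξ * Complex.I).re = 0 := by rw [h]; rfl
        simp at this
  refine tendsto_nhds_unique hlim (tendsto_const_nhds.congr' ?_)
  filter_upwards [self_mem_nhdsWithin] with r hr
  exact (hzero' r hr).symm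

/-! ### Multiplication by a boundary function -/

theorem IsHInfty.memLp_boundary_mul {g : ℂ → ℂ} (hg : IsHInfty g) (F : L2Line) :
    MemLp (fun ξ => boundary g ξ * F ξ) 2 volume := by
  obtain ⟨K, -, hK⟩ := hg.exists_bound
  refine (Lp.memLp F).of_le_mul (c := K)
    (hg.aestronglyMeasurable_boundary.mul (Lp.aestronglyMeasurable F)) ?_
  filter_upwards [hg.ae_norm_boundary_le hK] with ξ hξ
  rw [norm_mul]
  gcongr

theorem boundaryMul_coeFn {g : ℂ → ℂ} (hg : IsHInfty g) (F : L2Line) :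
    (boundaryMul g F : ℝ → ℂ) =ᵐ[volume] fun ξ => boundary g ξ * F ξ := by
  rw [boundaryMul, dif_pos (hg.memLp_boundary_mul F)]
  exact MemLp.coeFn_toLp _

/-- Multiplication by the boundary function of `g`, as a bounded operator on `L²(iℝ)`. -/
def boundaryMulL {g : ℂ → ℂ} (hg : IsHInfty g) : L2Line →L[ℂ] L2Line :=
  LinearMap.mkContinuousOfExistsBound
    { toFun := boundaryMul g
      map_add' := fun F G => by
        refine Lp.ext ?_
        filter_upwards [boundaryMul_coeFn hg (F + G), boundaryMul_coeFn hg F,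
          boundaryMul_coeFn hg G, Lp.coeFn_add F G,
          Lp.coeFn_add (boundaryMul g F) (boundaryMul g G)] with ξ h1 h2 h3 h4 h5
        rw [h1, h5, Pi.add_apply, h2, h3, h4, Pi.add_apply, mul_add]
      map_smul' := fun c F => by
        refine Lp.ext ?_
        filter_upwards [boundaryMul_coeFn hg (c • F), boundaryMul_coeFn hg F,
          Lp.coeFn_smul c F, Lp.coeFn_smul c (boundaryMul g F)] with ξ h1 h2 h3 h4
        rw [h1, RingHom.id_apply, h4, Pi.smul_apply, h2, h3, Pi.smul_apply, smul_eq_mul,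
          smul_eq_mul, mul_left_comm] }
    (by
      obtain ⟨K, -, hK⟩ := hg.exists_bound
      refine ⟨K, fun F => Lp.norm_le_mul_norm_of_ae_le_mul ?_⟩
      filter_upwards [boundaryMul_coeFn hg F, hg.ae_norm_boundary_le hK] with ξ h1 h2
      change ‖(boundaryMul g F : ℝ → ℂ) ξ‖ ≤ _
      rw [h1, norm_mul]
      gcongr)

theorem boundaryMulL_apply {g : ℂ → ℂ} (hg : IsHInfty g) (F : L2Line) :
    boundaryMulL hg F = boundaryMul g F := rfl

theorem boundaryMul_add_left {g₁ g₂ : ℂ → ℂ} (h₁ : IsHInfty g₁) (h₂ : IsHInfty g₂) (F : L2Line) :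
    boundaryMul (g₁ + g₂) F = boundaryMul g₁ F + boundaryMul g₂ F := by
  refine Lp.ext ?_
  filter_upwards [boundaryMul_coeFn (h₁.add h₂) F, boundaryMul_coeFn h₁ F, boundaryMul_coeFn h₂ F,
    Lp.coeFn_add (boundaryMul g₁ F) (boundaryMul g₂ F), boundary_add_ae h₁ h₂] with ξ e1 e2 e3 e4 e5
  rw [e1, e4, Pi.add_apply, e2, e3, e5, add_mul]

theorem boundaryMul_mul_left {g₁ g₂ : ℂ → ℂ} (h₁ : IsHInfty g₁) (h₂ : IsHInfty g₂) (F : L2Line) :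
    boundaryMul (g₁ * g₂) F = boundaryMul g₁ (boundaryMul g₂ F) := by
  refine Lp.ext ?_
  filter_upwards [boundaryMul_coeFn (h₁.mul h₂) F, boundaryMul_coeFn h₂ F,
    boundaryMul_coeFn h₁ (boundaryMul g₂ F), boundary_mul_ae h₁ h₂] with ξ e1 e2 e3 e4
  rw [e1, e3, e2, e4, mul_assoc]

theorem boundaryMul_eq_self {g : ℂ → ℂ} (hg : ∀ z : ℂ, z.re < 0 → g z = 1) (F : L2Line) :
    boundaryMul g F = F := by
  have h : (fun ξ => boundary g ξ * F ξ) = F := by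
    funext ξ
    rw [boundary_eq_one hg, one_mul]
  have h' : MemLp (fun ξ => boundary g ξ * F ξ) 2 volume := by rw [h]; exact Lp.memLp F
  rw [boundaryMul, dif_pos h']
  exact Lp.ext ((MemLp.coeFn_toLp h').trans (Eventually.of_forall fun ξ => congrFun h ξ))

/-! ### The Fourier transform on `L¹ ∩ L²` -/

/-- On `L¹ ∩ L²` the `L²` Fourier transform is given by the Fourier integral: both represent the
same tempered distribution. -/
theorem fourierTransform_toLp_ae_eq {f : ℝ → ℂ} (h1 : Integrable f) (h2 : MemLp f 2) :
    (Lp.fourierTransformₗᵢ ℝ ℂ h2.toLp : ℝ → ℂ) =ᵐ[volume] 𝓕 f := by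
  refine ae_eq_of_integral_contDiff_smul_eq
    ((Lp.memLp _).locallyIntegrable one_le_two) ?_ fun φ hφ hφc => ?_
  · have hc : Continuous (𝓕 f) :=
      VectorFourier.fourierIntegral_continuous Real.continuous_fourierChar
        (by exact continuous_inner) h1
    exact hc.locallyIntegrable
  · have hψ₁ : HasCompactSupport (Complex.ofRealCLM ∘ φ) := hφc.comp_left rfl
    have hψ₂ : ContDiff ℝ _ (Complex.ofRealCLM ∘ φ) := Complex.ofRealCLM.contDiff.comp hφ
    set ψ : SchwartzMap ℝ ℂ := hψ₁.toSchwartzMap hψ₂ with hψ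
    have hψa : ∀ x, ψ x = φ x := fun x => by simp [hψ]
    have e1 := congrArg (fun u => u ψ) (Lp.fourier_toTemperedDistribution_eq (h2.toLp : L2Line))
    simp only [TemperedDistribution.fourier_apply, Lp.toTemperedDistribution_apply] at e1
    have e2 := VectorFourier.integral_fourierIntegral_smul_eq_flip (L := innerₗ ℝ)
      (μ := volume) (ν := volume) Real.continuous_fourierChar
      (by exact continuous_inner) ψ.integrable h1
    rw [flip_innerₗ] at e2
    have e3 : ∫ x, (𝓕 ψ) x • (h2.toLp : L2Line) x = ∫ x, (𝓕 ψ) x • f x := by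
      refine integral_congr_ae ?_
      filter_upwards [h2.coeFn_toLp] with x hx
      rw [hx]
    rw [e3] at e1
    calc ∫ x, φ x • (Lp.fourierTransformₗᵢ ℝ ℂ h2.toLp : ℝ → ℂ) x
        = ∫ x, ψ x • (𝓕 (h2.toLp : L2Line) : L2Line) x :=
          integral_congr_ae (Eventually.of_forall fun x => by
            simp only [hψa, Complex.real_smul, smul_eq_mul]; rfl)
      _ = ∫ x, (𝓕 ψ) x • f x := e1.symm
      _ = ∫ x, ψ x • 𝓕 f x := e2
      _ = ∫ x, φ x • 𝓕 f x :=
          integral_congr_ae (Eventually.of_forall fun x => by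
            simp only [hψa, Complex.real_smul, smul_eq_mul])

/-! ### Truncated exponentials -/

/-- The function `t ↦ e^{-t}` restricted to `t > a`. -/
def expTailFun (a : ℝ) : ℝ → ℂ := (Set.Ioi a).indicator fun t => Complex.exp (-t)

theorem integrable_expTailFun (a : ℝ) : Integrable (expTailFun a) := by
  rw [expTailFun, integrable_indicator_iff measurableSet_Ioi]
  simpa using integrableOn_exp_mul_complex_Ioi (a := -1) (by simp) a

theorem memLp_expTailFun (a : ℝ) : MemLp (expTailFun a) 2 volume := by
  rw [expTailFun, memLp_indicator_iff_restrict measurableSet_Ioi,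
    memLp_two_iff_integrable_sq_norm (by fun_prop)]
  have h : IntegrableOn (fun t : ℝ => Real.exp (-2 * t)) (Set.Ioi a) :=
    integrableOn_exp_mul_Ioi (by norm_num) a
  refine h.congr (Eventually.of_forall fun t => ?_)
  simp only [Complex.norm_exp, ← Real.exp_nat_mul]
  congr 1
  simp

/-- `ε_a ∈ L²(0, ∞)`, the function `t ↦ e^{-t}` restricted to `t > a`. These functions span a dense
subspace, and a left shift by `a` turns `ε_a` into a multiple of `ε_0`. -/
def expTail (a : ℝ) : L2Pos := ((memLp_expTailFun a).restrict (Set.Ioi 0)).toLp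

/-- The reflection of `expTailFun a`, as an element of `L²(ℝ)`. -/
def expTailNeg (a : ℝ) : L2Line :=
  ((memLp_expTailFun a).comp_measurePreserving (Measure.measurePreserving_neg volume)).toLp

theorem extendZero_coeFn (f : L2Pos) :
    (extendZero f : ℝ → ℂ) =ᵐ[volume] (Set.Ioi (0 : ℝ)).indicator f :=
  (memLp_indicator f).coeFn_toLp

theorem extendZero_expTail {a : ℝ} (ha : 0 ≤ a) :
    extendZero (expTail a) = (memLp_expTailFun a).toLp := by
  refine Lp.ext ?_
  have h := (ae_restrict_iff' measurableSet_Ioi).1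
    ((memLp_expTailFun a).restrict (Set.Ioi 0)).coeFn_toLp
  filter_upwards [extendZero_coeFn (expTail a), (memLp_expTailFun a).coeFn_toLp, h]
    with t h1 h2 h3
  rw [h1, h2]
  by_cases ht : t ∈ Set.Ioi (0 : ℝ)
  · rw [Set.indicator_of_mem ht]
    exact h3 ht
  · rw [Set.indicator_of_notMem ht, expTailFun, Set.indicator_of_notMem]
    exact fun h => ht (lt_of_le_of_lt ha h)

theorem one_add_mul_I_ne_zero (ξ : ℝ) : (1 : ℂ) + 2 * Real.pi * ξ * Complex.I ≠ 0 := by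
  intro h
  have : ((1 : ℂ) + 2 * Real.pi * ξ * Complex.I).re = 0 := by rw [h]; rfl
  simp at this

theorem fourier_expTailFun (a ξ : ℝ) :
    𝓕 (expTailFun a) ξ = Complex.exp (-(1 + 2 * Real.pi * ξ * Complex.I) * a) /
      (1 + 2 * Real.pi * ξ * Complex.I) := by
  rw [Real.fourier_real_eq_integral_exp_smul]
  have h : ∀ t : ℝ, Complex.exp (↑(-2 * Real.pi * t * ξ) * Complex.I) • expTailFun a t =
      (Set.Ioi a).indicator
        (fun t : ℝ => Complex.exp (-(1 + 2 * Real.pi * ξ * Complex.I) * t)) t := by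
    intro t
    rw [expTailFun]
    by_cases ht : t ∈ Set.Ioi a
    · rw [Set.indicator_of_mem ht, Set.indicator_of_mem ht, smul_eq_mul, ← Complex.exp_add]
      congr 1
      push_cast
      ring
    · rw [Set.indicator_of_notMem ht, Set.indicator_of_notMem ht, smul_zero]
  simp_rw [h]
  rw [integral_indicator measurableSet_Ioi, integral_exp_mul_complex_Ioi (by simp), neg_div_neg_eq]

theorem laplace_expTail {a : ℝ} (ha : 0 ≤ a) :
    (laplace (expTail a) : ℝ → ℂ) =ᵐ[volume] fun ξ : ℝ =>
      Complex.exp (-(1 + 2 * Real.pi * ξ * Complex.I) * a) /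
        (1 + 2 * Real.pi * ξ * Complex.I) := by
  have h : laplace (expTail a) = Lp.fourierTransformₗᵢ ℝ ℂ (memLp_expTailFun a).toLp := by
    rw [← extendZero_expTail ha]
    rfl
  rw [h]
  filter_upwards [fourierTransform_toLp_ae_eq (integrable_expTailFun a) (memLp_expTailFun a)]
    with ξ hξ
  rw [hξ, fourier_expTailFun]

theorem fourierTransform_expTailNeg (a : ℝ) :
    (Lp.fourierTransformₗᵢ ℝ ℂ (expTailNeg a) : ℝ → ℂ) =ᵐ[volume] fun ξ : ℝ =>
      Complex.exp (-(1 - 2 * Real.pi * ξ * Complex.I) * a) /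
        (1 - 2 * Real.pi * ξ * Complex.I) := by
  filter_upwards [fourierTransform_toLp_ae_eq (integrable_expTailFun a).comp_neg
    ((memLp_expTailFun a).comp_measurePreserving (Measure.measurePreserving_neg volume))] with ξ hξ
  refine Eq.trans hξ ?_
  rw [← Real.fourierInv_eq_fourier_comp_neg, Real.fourierInv_eq_fourier_neg, fourier_expTailFun]
  push_cast
  ring_nf

theorem inner_expTail_eq {a : ℝ} (ha : 0 ≤ a) (f : L2Pos) :
    inner ℂ (expTail a) f = ∫ t in Set.Ioi a, Complex.exp (-t) * f t := by
  have h : ∀ᵐ t ∂volume.restrict (Set.Ioi (0 : ℝ)), inner ℂ (expTail a t) (f t) =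
      (Set.Ioi a).indicator (fun t : ℝ => Complex.exp (-t) * f t) t := by
    filter_upwards [((memLp_expTailFun a).restrict (Set.Ioi 0)).coeFn_toLp] with t ht
    rw [expTail, ht, expTailFun, RCLike.inner_apply]
    by_cases hta : t ∈ Set.Ioi a
    · rw [Set.indicator_of_mem hta, Set.indicator_of_mem hta, ← Complex.exp_conj]
      simp [mul_comm]
    · simp [Set.indicator_of_notMem hta]
  rw [L2.inner_def, integral_congr_ae h, setIntegral_indicator measurableSet_Ioi,
    Set.inter_eq_self_of_subset_right (Set.Ioi_subset_Ioi ha)]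

theorem inner_expTailNeg_eq (a : ℝ) (u : L2Line) :
    inner ℂ (expTailNeg a) u = ∫ t in Set.Ioi a, Complex.exp (-t) * u (-t) := by
  have h : ∀ᵐ t : ℝ, inner ℂ (expTailNeg a t) (u t) =
      (Set.Ioi a).indicator (fun t : ℝ => Complex.exp (-t) * u (-t)) (-t) := by
    filter_upwards [((memLp_expTailFun a).comp_measurePreserving
      (Measure.measurePreserving_neg volume)).coeFn_toLp] with t ht
    rw [expTailNeg, ht, Function.comp_apply, expTailFun, RCLike.inner_apply]
    by_cases hta : -t ∈ Set.Ioi a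
    · rw [Set.indicator_of_mem hta, Set.indicator_of_mem hta, ← Complex.exp_conj]
      simp [mul_comm]
    · simp [Set.indicator_of_notMem hta]
  rw [L2.inner_def, integral_congr_ae h,
    integral_neg_eq_self ((Set.Ioi a).indicator fun t : ℝ => Complex.exp (-t) * u (-t)),
    integral_indicator measurableSet_Ioi]

/-- A function on the half-line all of whose tail integrals vanish is zero, by Lebesgue's
differentiation theorem. -/
theorem ae_eq_zero_of_integral_Ioi_eq_zero {h : ℝ → ℂ} (hint : IntegrableOn h (Set.Ioi 0))
    (h0 : ∀ a : ℝ, 0 ≤ a → ∫ t in Set.Ioi a, h t = 0) : ∀ᵐ t : ℝ, 0 < t → h t = 0 := by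
  set H : ℝ → ℂ := (Set.Ioi (0 : ℝ)).indicator h with hH
  have hHint : Integrable H := (integrable_indicator_iff measurableSet_Ioi).2 hint
  have hprim : ∀ x : ℝ, 0 ≤ x → ∫ t in (0 : ℝ)..x, H t = 0 := by
    intro x hx
    have htail : ∀ a : ℝ, 0 ≤ a → ∫ t in Set.Ioi a, H t = 0 := fun a ha => by
      rw [← h0 a ha]
      exact setIntegral_congr_fun measurableSet_Ioi fun t ht =>
        Set.indicator_of_mem (lt_of_le_of_lt ha ht) _
    have := intervalIntegral.integral_interval_add_Ioi (a := (0 : ℝ)) (b := x) (f := H)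
      (hHint.integrableOn) (hHint.integrableOn)
    rwa [htail x hx, htail 0 le_rfl, add_zero] at this
  filter_upwards [LocallyIntegrable.ae_hasDerivAt_integral hHint.locallyIntegrable] with x hx hx0
  have h1 : HasDerivAt (fun x => ∫ t in (0 : ℝ)..x, H t) 0 x :=
    (hasDerivAt_const x (0 : ℂ)).congr_of_eventuallyEq (by
      filter_upwards [lt_mem_nhds hx0] with y hy
      exact hprim y hy.le)
  rw [← (hx 0).unique h1, hH, Set.indicator_of_mem (Set.mem_Ioi.2 hx0)]

theorem integrableOn_exp_mul {v : ℝ → ℂ} (hv : MemLp v 2 (volume.restrict (Set.Ioi 0))) :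
    IntegrableOn (fun t : ℝ => Complex.exp (-t) * v t) (Set.Ioi 0) := by
  have h := ((memLp_expTailFun 0).restrict (Set.Ioi 0)).integrable_mul hv
  refine h.congr ?_
  filter_upwards [ae_restrict_mem measurableSet_Ioi] with t ht
  rw [Pi.mul_apply, expTailFun, Set.indicator_of_mem ht]

theorem ae_eq_zero_of_integral_exp_mul {v : ℝ → ℂ}
    (hv : MemLp v 2 (volume.restrict (Set.Ioi 0)))
    (h0 : ∀ a : ℝ, 0 ≤ a → ∫ t in Set.Ioi a, Complex.exp (-t) * v t = 0) :
    ∀ᵐ t : ℝ, 0 < t → v t = 0 := by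
  filter_upwards [ae_eq_zero_of_integral_Ioi_eq_zero (integrableOn_exp_mul hv) h0] with t ht ht0
  exact (mul_eq_zero.1 (ht ht0)).resolve_left (Complex.exp_ne_zero _)

theorem eq_zero_of_inner_expTail {f : L2Pos}
    (h : ∀ a : ℝ, 0 ≤ a → inner ℂ (expTail a) f = 0) : f = 0 := by
  refine Lp.ext ?_
  have h1 := ae_eq_zero_of_integral_exp_mul (Lp.memLp f) fun a ha => by
    rw [← inner_expTail_eq ha, h a ha]
  filter_upwards [(ae_restrict_iff' measurableSet_Ioi).2 h1, Lp.coeFn_zero ℂ 2 _] with t ht h0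
  rw [ht, h0]
  rfl

theorem eq_of_inner_expTail {f g : L2Pos}
    (h : ∀ a : ℝ, 0 ≤ a → inner ℂ (expTail a) f = inner ℂ (expTail a) g) : f = g := by
  refine sub_eq_zero.1 (eq_zero_of_inner_expTail fun a ha => ?_)
  rw [inner_sub_right, h a ha, sub_self]

/-! ### The Hardy space and the Toeplitz operators -/

theorem mem_hardySpace_orthogonal {F : L2Line} :
    F ∈ hardySpaceᗮ ↔ ∀ h : L2Pos, inner ℂ (laplace h) F = 0 := by
  rw [Submodule.mem_orthogonal]
  constructor
  · exact fun hF h => hF _ ⟨h, rfl⟩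
  · rintro hF _ ⟨h, rfl⟩
    exact hF h

theorem inner_laplace_fourierTransform (h : L2Pos) (u : L2Line) :
    inner ℂ (laplace h) (Lp.fourierTransformₗᵢ ℝ ℂ u) = inner ℂ (extendZero h) u :=
  (Lp.fourierTransformₗᵢ ℝ ℂ).inner_map_map _ _

/-- The Fourier transform of a function vanishing on `(0, ∞)` is orthogonal to `H²`. -/
theorem fourierTransform_mem_hardySpace_orthogonal {u : L2Line} (hu : ∀ᵐ t : ℝ, 0 < t → u t = 0) :
    Lp.fourierTransformₗᵢ ℝ ℂ u ∈ hardySpaceᗮ := by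
  refine mem_hardySpace_orthogonal.2 fun h => ?_
  rw [inner_laplace_fourierTransform, L2.inner_def]
  refine integral_eq_zero_of_ae ?_
  filter_upwards [hu, extendZero_coeFn h] with t h1 h2
  by_cases ht : t ∈ Set.Ioi (0 : ℝ)
  · simp [h1 ht]
  · simp [h2, Set.indicator_of_notMem ht]

theorem fourierTransform_expTailNeg_mem {a : ℝ} (ha : 0 ≤ a) :
    Lp.fourierTransformₗᵢ ℝ ℂ (expTailNeg a) ∈ hardySpaceᗮ := by
  refine fourierTransform_mem_hardySpace_orthogonal ?_
  filter_upwards [((memLp_expTailFun a).comp_measurePreserving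
    (Measure.measurePreserving_neg volume)).coeFn_toLp] with t h1 ht
  rw [expTailNeg, h1, Function.comp_apply, expTailFun, Set.indicator_of_notMem]
  simp only [Set.mem_Ioi, not_lt]
  linarith

/-- The transforms of the reflected truncated exponentials are total in `(H²)ᗮ`. -/
theorem eq_zero_of_inner_expTailNeg {F : L2Line} (hF : F ∈ hardySpaceᗮ)
    (h : ∀ a : ℝ, 0 ≤ a → inner ℂ (Lp.fourierTransformₗᵢ ℝ ℂ (expTailNeg a)) F = 0) : F = 0 := by
  obtain ⟨u, rfl⟩ := (Lp.fourierTransformₗᵢ ℝ ℂ).surjective F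
  have hpos : ∀ᵐ t : ℝ, 0 < t → u t = 0 := by
    refine ae_eq_zero_of_integral_exp_mul ((Lp.memLp u).restrict _) fun a ha => ?_
    have h1 := mem_hardySpace_orthogonal.1 hF (expTail a)
    rw [inner_laplace_fourierTransform, extendZero_expTail ha, L2.inner_def] at h1
    rw [← h1, ← integral_indicator measurableSet_Ioi]
    refine integral_congr_ae ?_
    filter_upwards [(memLp_expTailFun a).coeFn_toLp] with t ht
    rw [ht, expTailFun, RCLike.inner_apply]
    by_cases hta : t ∈ Set.Ioi a
    · rw [Set.indicator_of_mem hta, Set.indicator_of_mem hta, ← Complex.exp_conj]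
      simp [mul_comm]
    · simp [Set.indicator_of_notMem hta]
  have hneg : ∀ᵐ t : ℝ, 0 < t → u (-t) = 0 := by
    refine ae_eq_zero_of_integral_exp_mul (((Lp.memLp u).comp_measurePreserving
      (Measure.measurePreserving_neg volume)).restrict _) fun a ha => ?_
    have h1 := h a ha
    rwa [LinearIsometryEquiv.inner_map_map, inner_expTailNeg_eq] at h1
  have hneg' : ∀ᵐ t : ℝ, 0 < -t → u t = 0 := by
    filter_upwards [(Measure.measurePreserving_neg
      (volume : Measure ℝ)).quasiMeasurePreserving.ae hneg] with t ht h0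
    simpa using ht h0
  have h0 : ∀ᵐ t : ℝ, t ≠ 0 := by simp [ae_iff, measure_singleton]
  have : u = 0 := by
    refine Lp.ext ?_
    filter_upwards [hpos, hneg', h0, Lp.coeFn_zero ℂ 2 _] with t h1 h2 h3 h4
    rw [h4]
    rcases lt_or_gt_of_ne h3 with h | h
    · exact h2 (by linarith)
    · exact h1 h
  rw [this, map_zero]

/-- The pairing of transforms of truncated exponentials through a boundary function is an integral
to which Cauchy's theorem applies. -/
theorem inner_laplace_boundaryMul_expTailNeg {g : ℂ → ℂ} (hg : IsHInfty g) {a b : ℝ} (ha : 0 ≤ a)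
    (hb : 0 ≤ b) : inner ℂ (laplace (expTail a))
      (boundaryMul g (Lp.fourierTransformₗᵢ ℝ ℂ (expTailNeg b))) = 0 := by
  have hexp : IsHInfty fun z => Complex.exp (-(a + b)) * Complex.exp ((a + b : ℝ) * z) :=
    IsHInfty.mul (g₁ := fun _ => Complex.exp (-(a + b)))
      ⟨differentiableOn_const _, _, fun _ _ => le_rfl⟩ (isHInfty_exp (add_nonneg ha hb))
  rw [← (hg.mul hexp).integral_boundary_div_sq, L2.inner_def]
  refine integral_congr_ae ?_
  filter_upwards [laplace_expTail ha, boundaryMul_coeFn hg (Lp.fourierTransformₗᵢ ℝ ℂ (expTailNeg b)),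
    fourierTransform_expTailNeg b, boundary_mul_ae hg hexp] with ξ h1 h2 h3 h4
  rw [h1, h2, h3, h4, RCLike.inner_apply, map_div₀, ← Complex.exp_conj,
    boundary_eq_of_continuous (g := fun z => Complex.exp (-(a + b)) * Complex.exp ((a + b : ℝ) * z))
      (by fun_prop)]
  simp only [map_mul, map_neg, map_add, map_one, Complex.conj_ofReal, Complex.conj_I,
    Complex.conj_ofNat, mul_neg, ← sub_eq_add_neg]
  have hne : (1 : ℂ) - 2 * Real.pi * ξ * Complex.I ≠ 0 := by
    simpa [← sub_eq_add_neg] using one_add_mul_I_ne_zero (-ξ)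
  have e : Complex.exp (-(1 - 2 * Real.pi * ξ * Complex.I) * b) *
      Complex.exp (-(1 - 2 * Real.pi * ξ * Complex.I) * a) =
      Complex.exp (-(a + b)) * Complex.exp ((a + b : ℝ) * (2 * Real.pi * ξ * Complex.I)) := by
    rw [← Complex.exp_add, ← Complex.exp_add]
    congr 1
    push_cast
    ring
  rw [← e]
  field_simp

theorem inner_laplaceInv_hardyProj (h : L2Pos) (F : L2Line) :
    inner ℂ h (laplaceInv (hardyProj F)) = inner ℂ (laplace h) F := by
  have h1 : inner ℂ h (laplaceInv (hardyProj F)) =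
      inner ℂ (laplace.equivRange h) (hardyProj F) := by
    rw [← laplace.equivRange.inner_map_map]
    congr 1
    exact laplace.equivRange.apply_symm_apply _
  rw [h1]
  exact Submodule.inner_orthogonalProjectionOnto_eq_of_mem_left (K := hardySpace) _ _

theorem laplaceInv_hardyProj_laplace (f : L2Pos) : laplaceInv (hardyProj (laplace f)) = f :=
  ext_inner_left ℂ fun h => by
    rw [inner_laplaceInv_hardyProj]
    exact laplace.inner_map_map h f

theorem laplaceInv_hardyProj_eq_zero {F : L2Line} (hF : F ∈ hardySpaceᗮ) :
    laplaceInv (hardyProj F) = 0 :=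
  ext_inner_left ℂ fun h => by
    rw [inner_laplaceInv_hardyProj, mem_hardySpace_orthogonal.1 hF h, inner_zero_right]

theorem sub_laplace_mem_hardySpace_orthogonal (F : L2Line) :
    F - laplace (laplaceInv (hardyProj F)) ∈ hardySpaceᗮ := by
  refine mem_hardySpace_orthogonal.2 fun h => ?_
  rw [inner_sub_right, laplace.inner_map_map, inner_laplaceInv_hardyProj, sub_self]

/-- Multiplication by the boundary function of `g ∈ H^∞` of the left half-plane maps `(H²)ᗮ`, which
is the Hardy space of the left half-plane, into itself. It suffices to test on truncated
exponentials on both sides. -/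
theorem boundaryMul_mem_hardySpace_orthogonal {g : ℂ → ℂ} (hg : IsHInfty g) {F : L2Line}
    (hF : F ∈ hardySpaceᗮ) : boundaryMul g F ∈ hardySpaceᗮ := by
  have key : ∀ a : ℝ, 0 ≤ a → inner ℂ (laplace (expTail a)) (boundaryMul g F) = 0 := by
    intro a ha
    rw [← boundaryMulL_apply hg, ← ContinuousLinearMap.adjoint_inner_left]
    set u := ContinuousLinearMap.adjoint (boundaryMulL hg) (laplace (expTail a)) with hu
    have hv : u - laplace (laplaceInv (hardyProj u)) = 0 := by
      refine eq_zero_of_inner_expTailNeg (sub_laplace_mem_hardySpace_orthogonal u) fun b hb => ?_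
      rw [inner_sub_right, inner_eq_zero_symm.1 (mem_hardySpace_orthogonal.1
        (fourierTransform_expTailNeg_mem hb) _), sub_zero, inner_eq_zero_symm, hu,
        ContinuousLinearMap.adjoint_inner_left, boundaryMulL_apply]
      exact inner_laplace_boundaryMul_expTailNeg hg ha hb
    rw [sub_eq_zero.1 hv]
    exact mem_hardySpace_orthogonal.1 hF _
  have h0 : laplaceInv (hardyProj (boundaryMul g F)) = 0 :=
    eq_zero_of_inner_expTail fun a ha => by rw [inner_laplaceInv_hardyProj, key a ha]
  refine mem_hardySpace_orthogonal.2 fun h => ?_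
  rw [← inner_laplaceInv_hardyProj, h0, inner_zero_right]

theorem inner_toeplitz (g : ℂ → ℂ) (h f : L2Pos) :
    inner ℂ h (toeplitz g f) = inner ℂ (laplace h) (boundaryMul g (laplace f)) :=
  inner_laplaceInv_hardyProj _ _

/-- The Toeplitz operator as a bounded operator. -/
def toeplitzL {g : ℂ → ℂ} (hg : IsHInfty g) : L2Pos →L[ℂ] L2Pos :=
  laplaceInv.toContinuousLinearMap ∘L hardyProj ∘L boundaryMulL hg ∘L
    laplace.toContinuousLinearMap

theorem toeplitz_eq_self {g : ℂ → ℂ} (hg : ∀ z : ℂ, z.re < 0 → g z = 1) (f : L2Pos) :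
    toeplitz g f = f := by
  rw [toeplitz, boundaryMul_eq_self hg, laplaceInv_hardyProj_laplace]

theorem toeplitz_add_left {g₁ g₂ : ℂ → ℂ} (h₁ : IsHInfty g₁) (h₂ : IsHInfty g₂) (f : L2Pos) :
    toeplitz (g₁ + g₂) f = toeplitz g₁ f + toeplitz g₂ f := by
  rw [toeplitz, boundaryMul_add_left h₁ h₂, map_add, map_add]
  rfl

/-- Toeplitz operators with symbols in `H^∞` of the left half-plane are multiplicative in the
symbol. -/
theorem toeplitz_mul_left {g₁ g₂ : ℂ → ℂ} (h₁ : IsHInfty g₁) (h₂ : IsHInfty g₂) (f : L2Pos) :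
    toeplitz (g₁ * g₂) f = toeplitz g₁ (toeplitz g₂ f) := by
  rw [toeplitz, boundaryMul_mul_left h₁ h₂]
  set F := boundaryMul g₂ (laplace f) with hF
  have h := laplaceInv_hardyProj_eq_zero (boundaryMul_mem_hardySpace_orthogonal h₁
    (sub_laplace_mem_hardySpace_orthogonal F))
  rw [← boundaryMulL_apply h₁, map_sub, map_sub, map_sub, sub_eq_zero] at h
  exact h

/-- The symbol `e^{a s}` acts as the left shift by `a`. -/
theorem toeplitz_exp {a : ℝ} (ha : 0 ≤ a) {φ : ℝ → ℂ}
    (hφ : MemLp φ 2 (volume.restrict (Set.Ioi 0))) (hφ₁ : IntegrableOn φ (Set.Ioi 0))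
    (hφa : MemLp (fun t => φ (t + a)) 2 (volume.restrict (Set.Ioi 0))) :
    toeplitz (fun z => Complex.exp (a * z)) hφ.toLp = hφa.toLp := by
  set f₀ : ℝ → ℂ := (Set.Ioi (0 : ℝ)).indicator φ with hf₀
  have hf₀1 : Integrable f₀ := (integrable_indicator_iff measurableSet_Ioi).2 hφ₁
  have hf₀2 : MemLp f₀ 2 volume := (memLp_indicator_iff_restrict measurableSet_Ioi).2 hφ
  have hs2 : MemLp (fun t => f₀ (t + a)) 2 volume :=
    hf₀2.comp_measurePreserving (measurePreserving_add_right volume a)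
  have hs1 : Integrable fun t => f₀ (t + a) := hf₀1.comp_add_right a
  have hext : ∀ {ψ : ℝ → ℂ} (hψ : MemLp ψ 2 (volume.restrict (Set.Ioi 0))),
      (extendZero hψ.toLp : ℝ → ℂ) =ᵐ[volume] (Set.Ioi (0 : ℝ)).indicator ψ := by
    intro ψ hψ
    filter_upwards [extendZero_coeFn hψ.toLp,
      (ae_restrict_iff' measurableSet_Ioi).1 hψ.coeFn_toLp] with t h1 h2
    rw [h1]
    by_cases ht : t ∈ Set.Ioi (0 : ℝ)
    · rw [Set.indicator_of_mem ht, Set.indicator_of_mem ht, h2 ht]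
    · rw [Set.indicator_of_notMem ht, Set.indicator_of_notMem ht]
  have hlap : laplace hφ.toLp = Lp.fourierTransformₗᵢ ℝ ℂ hf₀2.toLp := by
    change Lp.fourierTransformₗᵢ ℝ ℂ (extendZero hφ.toLp) = _
    congr 1
    exact Lp.ext ((hext hφ).trans hf₀2.coeFn_toLp.symm)
  have hmul : boundaryMul (fun z => Complex.exp (a * z)) (laplace hφ.toLp) =
      Lp.fourierTransformₗᵢ ℝ ℂ hs2.toLp := by
    refine Lp.ext ?_
    filter_upwards [boundaryMul_coeFn (isHInfty_exp ha) (laplace hφ.toLp),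
      fourierTransform_toLp_ae_eq hf₀1 hf₀2, fourierTransform_toLp_ae_eq hs1 hs2] with ξ h1 h2 h3
    rw [h1, h3, hlap, h2, boundary_eq_of_continuous (by fun_prop)]
    have h4 := congrFun (VectorFourier.fourierIntegral_comp_add_right Real.fourierChar volume
      (innerₗ ℝ) f₀ a) ξ
    refine Eq.trans ?_ h4.symm
    rw [Circle.smul_def, Real.fourierChar_apply, smul_eq_mul]
    congr 2
    simp
    ring
  have hsplit : laplaceInv (hardyProj (Lp.fourierTransformₗᵢ ℝ ℂ (hs2.toLp - extendZero hφa.toLp)))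
      = 0 := by
    refine laplaceInv_hardyProj_eq_zero (fourierTransform_mem_hardySpace_orthogonal ?_)
    filter_upwards [Lp.coeFn_sub hs2.toLp (extendZero hφa.toLp), hs2.coeFn_toLp, hext hφa]
      with t h1 h2 h3 ht
    rw [h1, Pi.sub_apply, h2, h3, hf₀, Set.indicator_of_mem (Set.mem_Ioi.2 ht),
      Set.indicator_of_mem (Set.mem_Ioi.2 (by linarith)), sub_self]
  rw [map_sub, map_sub, map_sub, sub_eq_zero] at hsplit
  rw [toeplitz, hmul, hsplit]
  exact laplaceInv_hardyProj_laplace _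

/-! ### Semigroup orbits and the generator -/

section Semigroup

variable {X : Type*} [NormedAddCommGroup X] [NormedSpace ℂ X]

namespace C0Semigroup

variable (S : C0Semigroup X)

/-- The orbit `t ↦ T(t) x`, extended to negative times by its value at `0`. -/
def orbit (x : X) (t : ℝ) : X := S.T t.toNNReal x

theorem orbit_zero (x : X) : S.orbit x 0 = x := by
  simp [orbit, S.map_zero]

theorem continuous_orbit_real (x : X) : Continuous (S.orbit x) :=
  (S.continuous_orbit x).comp continuous_real_toNNReal

theorem T_add_apply (s t : ℝ≥0) (x : X) : S.T (s + t) x = S.T s (S.T t x) := by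
  rw [S.map_add]
  rfl

theorem T_comm (s t : ℝ≥0) (x : X) : S.T s (S.T t x) = S.T t (S.T s x) := by
  rw [← T_add_apply, add_comm, T_add_apply]

theorem orbit_add {s t : ℝ} (hs : 0 ≤ s) (ht : 0 ≤ t) (x : X) :
    S.orbit x (s + t) = S.T s.toNNReal (S.orbit x t) := by
  rw [orbit, Real.toNNReal_add hs ht, T_add_apply, orbit]

theorem tendsto_generator (x : S.generator.domain) :
    Tendsto (fun t : ℝ => (t : ℂ)⁻¹ • (S.orbit x t - x)) (𝓝[>] 0) (𝓝 (S.generator x)) :=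
  tendsto_nhds_limUnder x.2

theorem exists_generator_eq {x z : X}
    (h : Tendsto (fun t : ℝ => (t : ℂ)⁻¹ • (S.orbit x t - x)) (𝓝[>] 0) (𝓝 z)) :
    ∃ hx : x ∈ S.generator.domain, S.generator ⟨x, hx⟩ = z :=
  ⟨⟨z, h⟩, h.limUnder_eq⟩

/-- A bounded operator commuting with the semigroup maps `D(A)` into itself and commutes with
`A`. -/
theorem exists_generator_eq_of_commute {B : X →L[ℂ] X} (hB : ∀ t x, B (S.T t x) = S.T t (B x))
    (x : S.generator.domain) :
    ∃ hx : B x ∈ S.generator.domain, S.generator ⟨B x, hx⟩ = B (S.generator x) := by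
  refine S.exists_generator_eq (((B.continuous.tendsto _).comp (S.tendsto_generator x)).congr
    fun t => ?_)
  simp [orbit, hB]

theorem generator_onDomain (t : ℝ≥0) (x : S.generator.domain) :
    S.generator (S.onDomain t x) = S.T t (S.generator x) :=
  (S.exists_generator_eq_of_commute (B := S.T t) (fun s x => S.T_comm t s x) x).2

theorem hasDerivWithinAt_orbit (x : S.generator.domain) {t : ℝ} (ht : 0 ≤ t) :
    HasDerivWithinAt (S.orbit x) (S.orbit (S.generator x) t) (Set.Ioi t) t := by
  rw [hasDerivWithinAt_iff_tendsto_slope' (Set.self_notMem_Ioi)]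
  have hshift : Tendsto (fun s : ℝ => s - t) (𝓝[>] t) (𝓝[>] 0) := by
    refine tendsto_nhdsWithin_iff.2 ⟨?_, ?_⟩
    · have : Tendsto (fun s : ℝ => s - t) (𝓝 t) (𝓝 (t - t)) :=
        (continuous_id.sub continuous_const).tendsto t
      rw [sub_self] at this
      exact this.mono_left nhdsWithin_le_nhds
    · filter_upwards [self_mem_nhdsWithin] with s hs
      exact sub_pos.2 (Set.mem_Ioi.1 hs)
  refine (((S.T t.toNNReal).continuous.tendsto _).comp
    ((S.tendsto_generator x).comp hshift)).congr' ?_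
  filter_upwards [self_mem_nhdsWithin] with s hs
  have hs' : 0 ≤ s - t := (sub_pos.2 hs).le
  have h := S.orbit_add ht hs' (x : X)
  rw [add_sub_cancel] at h
  simp only [Function.comp_apply, map_smul, map_sub, slope, vsub_eq_sub]
  rw [← h, ← Complex.ofReal_inv, Complex.coe_smul]
  rfl

theorem ExpStable.exists_bound {S : C0Semigroup X} (hS : S.ExpStable) :
    ∃ M ω : ℝ, 0 ≤ M ∧ ω < 0 ∧
      ∀ t : ℝ, 0 ≤ t → ∀ x, ‖S.orbit x t‖ ≤ M * Real.exp (ω * t) * ‖x‖ := by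
  obtain ⟨M, ω, hω, hM⟩ := hS
  refine ⟨M, ω, ?_, hω, fun t ht x => ?_⟩
  · simpa using (norm_nonneg _).trans (hM 0)
  · refine ((S.T t.toNNReal).le_opNorm x).trans ?_
    have := hM t.toNNReal
    rw [Real.coe_toNNReal t ht] at this
    gcongr

theorem ExpStable.memLp_orbit_norm {S : C0Semigroup X} (hS : S.ExpStable) (x : X) :
    MemLp (S.orbit x) 2 (volume.restrict (Set.Ioi (0 : ℝ))) := by
  obtain ⟨M, ω, hM, hω, hb⟩ := hS.exists_bound
  have hexp : MemLp (fun t : ℝ => Real.exp (ω * t)) 2 (volume.restrict (Set.Ioi (0 : ℝ))) := by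
    rw [memLp_two_iff_integrable_sq (by fun_prop)]
    have h : IntegrableOn (fun t : ℝ => Real.exp ((2 * ω) * t)) (Set.Ioi 0) :=
      integrableOn_exp_mul_Ioi (by linarith) 0
    refine h.congr (Eventually.of_forall fun t => ?_)
    simp only [← Real.exp_nat_mul]
    congr 1
    push_cast
    ring
  refine hexp.of_le_mul (c := M * ‖x‖) (S.continuous_orbit_real x).aestronglyMeasurable ?_
  filter_upwards [ae_restrict_mem measurableSet_Ioi] with t ht
  rw [Real.norm_of_nonneg (Real.exp_pos _).le]
  exact (hb t (le_of_lt ht) x).trans (le_of_eq (by ring))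

/-- `e^{-r t} T(t) x` is integrable for `r ≥ 0`. -/
theorem ExpStable.integrableOn_exp_smul_orbit {S : C0Semigroup X} (hS : S.ExpStable) {r : ℝ}
    (hr : 0 ≤ r) (x : X) :
    IntegrableOn (fun t : ℝ => Real.exp (-(r * t)) • S.orbit x t) (Set.Ioi 0) := by
  obtain ⟨M, ω, hM, hω, hb⟩ := hS.exists_bound
  have h : IntegrableOn (fun t : ℝ => M * ‖x‖ * Real.exp (ω * t)) (Set.Ioi 0) :=
    (integrableOn_exp_mul_Ioi hω 0).const_mul _
  refine h.mono' ?_ ?_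
  · have := S.continuous_orbit_real x
    exact Continuous.aestronglyMeasurable (by fun_prop)
  · filter_upwards [ae_restrict_mem measurableSet_Ioi] with t ht
    have ht : 0 < t := ht
    rw [norm_smul, Real.norm_of_nonneg (Real.exp_pos _).le]
    have h1 : Real.exp (-(r * t)) ≤ 1 := Real.exp_le_one_iff.2 (by nlinarith)
    calc _ ≤ 1 * (M * Real.exp (ω * t) * ‖x‖) :=
          mul_le_mul h1 (hb t ht.le x) (norm_nonneg _) zero_le_one
      _ = _ := by ring

/-- The Laplace integral `∫₀^∞ e^{-r t} T(t) x dt`, which represents the resolvent. -/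
def laplaceInt (S : C0Semigroup X) (r : ℝ) (x : X) : X :=
  ∫ t in Set.Ioi (0 : ℝ), Real.exp (-(r * t)) • S.orbit x t

theorem ExpStable.norm_laplaceInt_le {S : C0Semigroup X} (hS : S.ExpStable) {r : ℝ} (hr : 0 ≤ r) :
    ∃ K : ℝ, ∀ x, ‖S.laplaceInt r x‖ ≤ K * ‖x‖ := by
  obtain ⟨M, ω, hM, hω, hb⟩ := hS.exists_bound
  refine ⟨∫ t in Set.Ioi (0 : ℝ), M * Real.exp (ω * t), fun x => ?_⟩
  rw [← integral_mul_const]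
  refine norm_integral_le_of_norm_le
    (((integrableOn_exp_mul_Ioi hω 0).const_mul M).mul_const ‖x‖) ?_
  filter_upwards [ae_restrict_mem measurableSet_Ioi] with t ht
  have ht : 0 < t := ht
  rw [norm_smul, Real.norm_of_nonneg (Real.exp_pos _).le]
  have h1 : Real.exp (-(r * t)) ≤ 1 := Real.exp_le_one_iff.2 (by nlinarith)
  exact (mul_le_mul h1 (hb t ht.le x) (norm_nonneg _) zero_le_one).trans (one_mul _).le

variable [CompleteSpace X]

/-- Integrating the derivative of `e^{-r t} T(t) x`. -/
theorem ExpStable.integral_exp_smul_orbit {S : C0Semigroup X} (hS : S.ExpStable) {r : ℝ}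
    (hr : 0 ≤ r) (x : S.generator.domain) {a : ℝ} (ha : 0 ≤ a) :
    ∫ t in Set.Ioi a, Real.exp (-(r * t)) • S.orbit (r • (x : X) - S.generator x) t =
      Real.exp (-(r * a)) • S.orbit (x : X) a := by
  set z := r • (x : X) - S.generator x with hz
  have hint : IntegrableOn (fun t : ℝ => Real.exp (-(r * t)) • S.orbit z t) (Set.Ioi a) :=
    (hS.integrableOn_exp_smul_orbit hr z).mono_set (Set.Ioi_subset_Ioi ha)
  have hc : ∀ x : X, Continuous fun t : ℝ => Real.exp (-(r * t)) • S.orbit x t := fun x => by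
    have := S.continuous_orbit_real x
    fun_prop
  have hfin : ∀ b : ℝ, a ≤ b → ∫ t in a..b, Real.exp (-(r * t)) • S.orbit z t =
      Real.exp (-(r * a)) • S.orbit (x : X) a - Real.exp (-(r * b)) • S.orbit (x : X) b := by
    intro b hab
    have h := intervalIntegral.integral_eq_sub_of_hasDeriv_right_of_le hab
      (f := fun t : ℝ => -(Real.exp (-(r * t)) • S.orbit (x : X) t))
      (f' := fun t : ℝ => Real.exp (-(r * t)) • S.orbit z t) (hc x).neg.continuousOn
      (fun t ht => ?_) ((hc z).intervalIntegrable _ _)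
    · rw [h]
      abel
    · have h1 : HasDerivWithinAt (fun t : ℝ => Real.exp (-(r * t)))
          (Real.exp (-(r * t)) * (-(r * 1))) (Set.Ioi t) t :=
        (((hasDerivAt_id t).const_mul r).neg.exp).hasDerivWithinAt
      refine (h1.smul (S.hasDerivWithinAt_orbit x (ha.trans ht.1.le))).neg.congr_deriv ?_
      rw [hz]
      simp only [orbit, map_sub, mul_one, smul_sub, ← Complex.coe_smul, map_smul]
      simp only [smul_smul]
      push_cast
      module
  have hlim : Tendsto (fun b : ℝ => Real.exp (-(r * b)) • S.orbit (x : X) b) atTop (𝓝 0) := by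
    obtain ⟨M, ω, hM, hω, hb⟩ := hS.exists_bound
    have h0 : Tendsto (fun t : ℝ => M * Real.exp (ω * t) * ‖(x : X)‖) atTop (𝓝 0) := by
      have : Tendsto (fun t : ℝ => Real.exp (ω * t)) atTop (𝓝 0) :=
        Real.tendsto_exp_atBot.comp ((tendsto_const_mul_atBot_of_neg hω).2 tendsto_id)
      simpa using (this.const_mul M).mul_const ‖(x : X)‖
    refine squeeze_zero_norm' ?_ h0
    filter_upwards [eventually_ge_atTop 0] with t ht
    rw [norm_smul, Real.norm_of_nonneg (Real.exp_pos _).le]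
    have h1 : Real.exp (-(r * t)) ≤ 1 := Real.exp_le_one_iff.2 (by nlinarith)
    exact (mul_le_mul h1 (hb t ht x) (norm_nonneg _) zero_le_one).trans (one_mul _).le
  refine tendsto_nhds_unique (intervalIntegral_tendsto_integral_Ioi a hint tendsto_id) ?_
  have h2 := (tendsto_const_nhds (x := Real.exp (-(r * a)) • S.orbit (x : X) a)).sub hlim
  rw [sub_zero] at h2
  refine h2.congr' ?_
  filter_upwards [eventually_ge_atTop a] with b hb
  exact (hfin b hb).symm

theorem ExpStable.exists_generator_laplaceInt {S : C0Semigroup X} (hS : S.ExpStable) {r : ℝ}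
    (hr : 0 ≤ r) (z : X) :
    ∃ hx : S.laplaceInt r z ∈ S.generator.domain,
      S.generator ⟨S.laplaceInt r z, hx⟩ = r • S.laplaceInt r z - z := by
  set f : ℝ → X := fun t => Real.exp (-(r * t)) • S.orbit z t with hf
  have hfc : Continuous f := by
    have := S.continuous_orbit_real z
    fun_prop
  have hfi : IntegrableOn f (Set.Ioi 0) := hS.integrableOn_exp_smul_orbit hr z
  set φ : ℝ → X := fun h => Real.exp (r * h) • (S.laplaceInt r z - ∫ t in (0 : ℝ)..h, f t) with hφ
  have hshift : ∀ h : ℝ, 0 < h → S.orbit (S.laplaceInt r z) h = φ h := by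
    intro h hh
    have h1 : S.laplaceInt r z - ∫ t in (0 : ℝ)..h, f t = ∫ t in Set.Ioi h, f t := by
      rw [sub_eq_iff_eq_add', intervalIntegral.integral_interval_add_Ioi hfi
        (hfi.mono_set (Set.Ioi_subset_Ioi hh.le))]
      rfl
    have h2 : S.orbit (S.laplaceInt r z) h =
        ∫ t in Set.Ioi (0 : ℝ), S.T h.toNNReal (f t) :=
      (ContinuousLinearMap.integral_comp_comm (S.T h.toNNReal) hfi).symm
    have h3 : ∫ t in Set.Ioi (0 : ℝ), S.T h.toNNReal (f t) =
        ∫ t in Set.Ioi (0 : ℝ), Real.exp (r * h) • f (t + h) := by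
      refine setIntegral_congr_fun measurableSet_Ioi fun t ht => ?_
      simp only [hf, ← Complex.coe_smul, map_smul]
      rw [← S.orbit_add hh.le (le_of_lt ht), smul_smul, add_comm h t, ← Complex.ofReal_mul,
        ← Real.exp_add]
      congr 3
      ring
    have h4 : ∫ t in Set.Ioi (0 : ℝ), f (t + h) = ∫ t in Set.Ioi h, f t := by
      have := (measurePreserving_add_right volume h).setIntegral_preimage_emb
        (measurableEmbedding_addRight h) f (Set.Ioi h)
      rwa [Set.preimage_add_const_Ioi, sub_self] at this
    rw [h2, h3, integral_smul, h4, hφ]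
    simp only [h1]
  have hder : HasDerivAt φ (r • S.laplaceInt r z - z) 0 := by
    have h1 : HasDerivAt (fun h : ℝ => Real.exp (r * h)) (Real.exp (r * 0) * (r * 1)) 0 :=
      ((hasDerivAt_id (0 : ℝ)).const_mul r).exp
    have h2 : HasDerivAt (fun h : ℝ => S.laplaceInt r z - ∫ t in (0 : ℝ)..h, f t) (-f 0) 0 :=
      (intervalIntegral.integral_hasDerivAt_right (hfc.intervalIntegrable _ _)
        (hfc.stronglyMeasurableAtFilter _ _) hfc.continuousAt).const_sub _
    refine (h1.smul h2).congr_deriv ?_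
    simp [hf, orbit_zero]
    abel
  refine S.exists_generator_eq ?_
  have hs := (hasDerivAt_iff_tendsto_slope.1 hder).mono_left
    (nhdsWithin_mono (0 : ℝ) fun t (ht : 0 < t) => ht.ne')
  refine hs.congr' ?_
  filter_upwards [self_mem_nhdsWithin] with h hh
  have hφ0 : φ 0 = S.laplaceInt r z := by simp [hφ]
  rw [slope, vsub_eq_sub, sub_zero, hφ0, ← hshift h hh, ← Complex.ofReal_inv, Complex.coe_smul]

theorem ExpStable.laplaceInt_sub {S : C0Semigroup X} (hS : S.ExpStable) {r : ℝ} (hr : 0 ≤ r)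
    (x : S.generator.domain) : S.laplaceInt r (r • (x : X) - S.generator x) = x := by
  rw [laplaceInt, hS.integral_exp_smul_orbit hr x le_rfl]
  simp [orbit_zero]

theorem ExpStable.bijective {S : C0Semigroup X} (hS : S.ExpStable) {r : ℝ} (hr : 0 ≤ r) :
    Function.Bijective ((r : ℂ) • S.generator.domain.subtype - S.generator.toFun) := by
  have happ : ∀ x, ((r : ℂ) • S.generator.domain.subtype - S.generator.toFun) x =
      r • (x : X) - S.generator x := fun x => by simp
  constructor
  · intro x x' h
    rw [happ, happ] at h
    exact Subtype.ext (by rw [← hS.laplaceInt_sub hr x, h, hS.laplaceInt_sub hr x'])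
  · intro z
    obtain ⟨hx, h⟩ := hS.exists_generator_laplaceInt hr z
    refine ⟨⟨_, hx⟩, ?_⟩
    rw [happ, h, sub_sub_cancel]

theorem ExpStable.coe_resolvent {S : C0Semigroup X} (hS : S.ExpStable) {r : ℝ} (hr : 0 ≤ r)
    (z : X) : (resolvent S.generator r z : X) = S.laplaceInt r z := by
  obtain ⟨hx, h⟩ := hS.exists_generator_laplaceInt hr z
  have : resolvent S.generator r z = ⟨S.laplaceInt r z, hx⟩ := by
    rw [resolvent, dif_pos (hS.bijective hr), LinearEquiv.coe_coe, LinearEquiv.symm_apply_eq,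
      LinearEquiv.ofBijective_apply]
    have h' : S.generator.toFun ⟨S.laplaceInt r z, hx⟩ = r • S.laplaceInt r z - z := h
    simp [h']
  rw [this]

theorem ExpStable.generator_resolvent {S : C0Semigroup X} (hS : S.ExpStable) {r : ℝ} (hr : 0 ≤ r)
    (z : X) : S.generator (resolvent S.generator r z) = r • S.laplaceInt r z - z := by
  obtain ⟨hx, h⟩ := hS.exists_generator_laplaceInt hr z
  rw [← h]
  congr 1
  exact Subtype.ext (hS.coe_resolvent hr z)

theorem ExpStable.laplaceInt_commute {S : C0Semigroup X} (hS : S.ExpStable) {r : ℝ} (hr : 0 ≤ r)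
    {B : X →L[ℂ] X} (hB : ∀ t x, B (S.T t x) = S.T t (B x)) (x : X) :
    B (S.laplaceInt r x) = S.laplaceInt r (B x) := by
  rw [laplaceInt, ← ContinuousLinearMap.integral_comp_comm B (hS.integrableOn_exp_smul_orbit hr x)]
  refine setIntegral_congr_fun measurableSet_Ioi fun t _ => ?_
  simp only [orbit, ← Complex.coe_smul, map_smul, hB]

/-- `r R(r, A) x → x` as `r → ∞`. -/
theorem ExpStable.tendsto_smul_laplaceInt {S : C0Semigroup X} (hS : S.ExpStable) (x : X) :
    Tendsto (fun r : ℝ => r • S.laplaceInt r x) atTop (𝓝 x) := by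
  obtain ⟨M, ω, hM, hω, hb⟩ := hS.exists_bound
  have hexp : IntegrableOn (fun u : ℝ => Real.exp (-u)) (Set.Ioi 0) := by
    simpa using integrableOn_exp_mul_Ioi (a := -1) (by norm_num) 0
  have hlim : Tendsto (fun r : ℝ => ∫ u in Set.Ioi (0 : ℝ), Real.exp (-u) • S.orbit x (r⁻¹ * u))
      atTop (𝓝 (∫ u in Set.Ioi (0 : ℝ), Real.exp (-u) • x)) := by
    refine tendsto_integral_filter_of_dominated_convergence
      (fun u => Real.exp (-u) * (M * ‖x‖)) ?_ ?_ (hexp.mul_const _) ?_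
    · refine Eventually.of_forall fun r => ?_
      have := S.continuous_orbit_real x
      exact Continuous.aestronglyMeasurable (by fun_prop)
    · filter_upwards [eventually_gt_atTop 0] with r hr
      filter_upwards [ae_restrict_mem measurableSet_Ioi] with u hu
      have hu : 0 < u := hu
      rw [norm_smul, Real.norm_of_nonneg (Real.exp_pos _).le]
      have h1 : 0 ≤ r⁻¹ * u := by positivity
      have h2 : Real.exp (ω * (r⁻¹ * u)) ≤ 1 := Real.exp_le_one_iff.2 (by nlinarith)
      have h3 := hb _ h1 x
      gcongr
      refine h3.trans ?_
      gcongr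
      exact mul_le_of_le_one_right hM h2
    · refine Eventually.of_forall fun u => ?_
      have h1 : Tendsto (fun r : ℝ => r⁻¹ * u) atTop (𝓝 0) := by
        simpa using tendsto_inv_atTop_zero.mul_const u
      have h2 := ((S.continuous_orbit_real x).tendsto 0).comp h1
      rw [orbit_zero] at h2
      exact h2.const_smul _
  rw [integral_smul_const, integral_exp_neg_Ioi_zero, one_smul] at hlim
  refine hlim.congr' ?_
  filter_upwards [eventually_gt_atTop 0] with r hr
  have h := integral_comp_mul_left_Ioi
    (fun u => Real.exp (-u) • S.orbit x (r⁻¹ * u)) 0 hr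
  rw [mul_zero] at h
  have h' : S.laplaceInt r x = r⁻¹ • ∫ u in Set.Ioi (0 : ℝ), Real.exp (-u) • S.orbit x (r⁻¹ * u) := by
    rw [← h, laplaceInt]
    refine setIntegral_congr_fun measurableSet_Ioi fun t _ => ?_
    simp only [inv_mul_cancel_left₀ hr.ne']
  rw [h', smul_inv_smul₀ hr.ne']

theorem ExpStable.continuous_laplaceInt {S : C0Semigroup X} (hS : S.ExpStable) {r : ℝ}
    (hr : 0 ≤ r) : Continuous (S.laplaceInt r) := by
  obtain ⟨K, hK⟩ := hS.norm_laplaceInt_le hr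
  have h : S.laplaceInt r =
      S.generator.domain.subtype ∘ₗ resolvent S.generator (r : ℂ) := by
    funext x
    exact (hS.coe_resolvent hr x).symm
  rw [h]
  refine AddMonoidHomClass.continuous_of_bound _ K fun x => ?_
  rw [← h]
  exact hK x

/-- An operator `∫₀^∞ conj κ(u) T(u) du` with `κ ∈ L²(0, ∞)` is bounded and commutes with the
semigroup. -/
theorem ExpStable.exists_integral_operator {S : C0Semigroup X} (hS : S.ExpStable) (κ : L2Pos) :
    ∃ B : X →L[ℂ] X, (∀ t x, B (S.T t x) = S.T t (B x)) ∧
      ∀ (y : X →L[ℂ] ℂ) (x : X), y (B x) = inner ℂ κ (memLp_orbit S hS y x).toLp := by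
  obtain ⟨M, ω, hM, hω, hb⟩ := hS.exists_bound
  have hint : ∀ x, IntegrableOn (fun u : ℝ => (starRingEnd ℂ) (κ u) • S.orbit x u)
      (Set.Ioi 0) := fun x =>
    memLp_one_iff_integrable.1 ((hS.memLp_orbit_norm x).smul (p := 2) (q := 2) (Lp.memLp κ).star)
  have hexp : IntegrableOn (fun u : ℝ => ‖κ u‖ * (M * Real.exp (ω * u))) (Set.Ioi 0) := by
    refine MemLp.integrable_mul (p := 2) (q := 2) (Lp.memLp κ).norm (MemLp.const_mul ?_ M)
    rw [memLp_two_iff_integrable_sq (by fun_prop)]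
    have h : IntegrableOn (fun t : ℝ => Real.exp ((2 * ω) * t)) (Set.Ioi 0) :=
      integrableOn_exp_mul_Ioi (by linarith) 0
    refine h.congr (Eventually.of_forall fun t => ?_)
    simp only [← Real.exp_nat_mul]
    congr 1
    push_cast
    ring
  let L : X →ₗ[ℂ] X :=
    { toFun := fun x => ∫ u in Set.Ioi (0 : ℝ), (starRingEnd ℂ) (κ u) • S.orbit x u
      map_add' := fun x x' => by
        rw [← integral_add (hint x) (hint x')]
        simp [orbit]
      map_smul' := fun c x => by
        rw [RingHom.id_apply, ← integral_smul]
        refine integral_congr_ae (Eventually.of_forall fun u => ?_)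
        simp only [orbit, map_smul]
        rw [smul_comm] }
  let B : X →L[ℂ] X := L.mkContinuous
    (∫ u in Set.Ioi (0 : ℝ), ‖κ u‖ * (M * Real.exp (ω * u))) (fun x => by
      rw [← integral_mul_const]
      refine norm_integral_le_of_norm_le (hexp.mul_const ‖x‖) ?_
      filter_upwards [ae_restrict_mem measurableSet_Ioi] with t ht
      rw [norm_smul, RCLike.norm_conj, mul_assoc]
      exact mul_le_mul_of_nonneg_left (hb t (le_of_lt ht) x) (norm_nonneg _))
  have hB : ∀ x, B x = ∫ u in Set.Ioi (0 : ℝ), (starRingEnd ℂ) (κ u) • S.orbit x u :=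
    fun x => rfl
  refine ⟨B, fun t x => ?_, fun y x => ?_⟩
  · rw [hB, hB, ← ContinuousLinearMap.integral_comp_comm _ (hint x)]
    refine integral_congr_ae (Eventually.of_forall fun u => ?_)
    simp only [orbit, map_smul]
    rw [S.T_comm]
  · rw [hB, ← ContinuousLinearMap.integral_comp_comm _ (hint x), L2.inner_def]
    refine integral_congr_ae ?_
    filter_upwards [(memLp_orbit S hS y x).coeFn_toLp] with u hu
    rw [hu, RCLike.inner_apply, map_smul, smul_eq_mul, mul_comm]
    rfl

end C0Semigroup

end Semigroup

section Existence

variable {X : Type*} [NormedAddCommGroup X] [NormedSpace ℂ X]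

/-! ### Graphs of sums, products and Lambda extensions -/

theorem mem_graph_calcExt (S : C0Semigroup X) (hS : S.ExpStable) (g : ℂ → ℂ) {x z : X} :
    (x, z) ∈ (calcExt S hS g).graph ↔
      Tendsto (fun r : ℝ => (r : ℂ) • calcOp S hS g (resolvent S.generator r x)) atTop (𝓝 z) := by
  rw [LinearPMap.mem_graph_iff]
  constructor
  · rintro ⟨⟨x', hx'⟩, rfl, rfl⟩
    exact tendsto_nhds_limUnder hx'
  · exact fun h => ⟨⟨x, ⟨z, h⟩⟩, rfl, h.limUnder_eq⟩

theorem mem_domain_calcExt (S : C0Semigroup X) (hS : S.ExpStable) (g : ℂ → ℂ) {x : X} :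
    x ∈ (calcExt S hS g).domain ↔ ∃ z, (x, z) ∈ (calcExt S hS g).graph := by
  rw [LinearPMap.mem_domain_iff]

theorem mem_graph_add {F G : X →ₗ.[ℂ] X} {x z : X} :
    (x, z) ∈ (F + G).graph ↔ ∃ u v, (x, u) ∈ F.graph ∧ (x, v) ∈ G.graph ∧ z = u + v := by
  constructor
  · intro h
    obtain ⟨⟨x', hF, hG⟩, rfl, rfl⟩ := LinearPMap.mem_graph_iff _ |>.1 h
    exact ⟨F ⟨x', hF⟩, G ⟨x', hG⟩, F.mem_graph ⟨x', hF⟩, G.mem_graph ⟨x', hG⟩, rfl⟩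
  · rintro ⟨u, v, hu, hv, rfl⟩
    obtain ⟨⟨x', hF⟩, rfl, rfl⟩ := LinearPMap.mem_graph_iff _ |>.1 hu
    obtain ⟨⟨x'', hG⟩, h, rfl⟩ := LinearPMap.mem_graph_iff _ |>.1 hv
    obtain rfl : x'' = x' := h
    exact (F + G).mem_graph ⟨x'', hF, hG⟩

theorem mem_graph_opMul {F G : X →ₗ.[ℂ] X} {x z : X} :
    (x, z) ∈ (opMul F G).graph ↔ ∃ u, (x, u) ∈ G.graph ∧ (u, z) ∈ F.graph := by
  constructor
  · intro h
    obtain ⟨⟨x', hG, hF⟩, rfl, rfl⟩ := LinearPMap.mem_graph_iff _ |>.1 h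
    exact ⟨G ⟨x', hG⟩, G.mem_graph ⟨x', hG⟩, F.mem_graph ⟨G ⟨x', hG⟩, hF⟩⟩
  · rintro ⟨u, hu, hz⟩
    obtain ⟨⟨x', hG⟩, rfl, rfl⟩ := LinearPMap.mem_graph_iff _ |>.1 hu
    obtain ⟨⟨u', hF⟩, h, rfl⟩ := LinearPMap.mem_graph_iff _ |>.1 hz
    obtain rfl : u' = G ⟨x', hG⟩ := h
    exact (opMul F G).mem_graph ⟨x', hG, hF⟩

/-! ### Existence and uniqueness of `g(A)` -/

theorem apply_zero_eq_of_ae_eq {p q : ℝ → ℂ} (hp : Continuous p) (hq : Continuous q)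
    (h : p =ᵐ[volume.restrict (Set.Ioi (0 : ℝ))] q) : p 0 = q 0 := by
  have h1 : Set.EqOn p q (Set.Ioi 0) :=
    Measure.eqOn_open_of_ae_eq h isOpen_Ioi hp.continuousOn hq.continuousOn
  exact h1.closure hp hq (by rw [closure_Ioi]; exact Set.self_mem_Ici)

/-- The operator `g(A)` is determined by its defining property, because `t ↦ C T(t) x` is continuous
for `x ∈ D(A)`. -/
theorem IsCalculusOp.unique {S : C0Semigroup X} {hS : S.ExpStable} {g : ℂ → ℂ}
    {C C' : S.generator.domain →ₗ[ℂ] X} (h : IsCalculusOp S hS g C)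
    (h' : IsCalculusOp S hS g C') : C = C' := by
  have hcont : ∀ {C : S.generator.domain →ₗ[ℂ] X}, IsCalculusOp S hS g C →
      ∀ x, Continuous fun t : ℝ => C (S.onDomain t.toNNReal x) := by
    rintro C ⟨⟨K, hK⟩, -⟩ x
    refine continuous_iff_continuousAt.2 fun s => tendsto_iff_norm_sub_tendsto_zero.2 ?_
    have h0 : Tendsto (fun t : ℝ => K * (‖S.orbit (x : X) t - S.orbit (x : X) s‖ +
        ‖S.orbit (S.generator x) t - S.orbit (S.generator x) s‖)) (𝓝 s) (𝓝 0) := by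
      have e1 := tendsto_iff_norm_sub_tendsto_zero.1 ((S.continuous_orbit_real (x : X)).tendsto s)
      have e2 := tendsto_iff_norm_sub_tendsto_zero.1
        ((S.continuous_orbit_real (S.generator x)).tendsto s)
      simpa using (e1.add e2).const_mul K
    refine squeeze_zero (fun t => norm_nonneg _) (fun t => ?_) h0
    have e := hK (S.onDomain t.toNNReal x - S.onDomain s.toNNReal x)
    rw [map_sub, LinearPMap.map_sub, S.generator_onDomain, S.generator_onDomain] at e
    exact e
  have hzero : ∀ x, S.onDomain (0 : ℝ).toNNReal x = x := fun x =>
    Subtype.ext (S.orbit_zero (x : X))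
  refine LinearMap.ext fun x => ?_
  refine SeparatingDual.eq_iff_forall_dual_eq (R := ℂ) |>.2 fun y => ?_
  have e := apply_zero_eq_of_ae_eq (y.continuous.comp (hcont h x)) (y.continuous.comp (hcont h' x))
    ((h.2 y x).symm.trans (h'.2 y x))
  simpa only [Function.comp_apply, hzero] using e

theorem calcOp_eq {S : C0Semigroup X} {hS : S.ExpStable} {g : ℂ → ℂ}
    {C : S.generator.domain →ₗ[ℂ] X} (h : IsCalculusOp S hS g C) : calcOp S hS g = C := by
  have hex : ∃ C, IsCalculusOp S hS g C := ⟨C, h⟩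
  rw [calcOp, dif_pos hex]
  exact hex.choose_spec.unique h

theorem calcOp_one (S : C0Semigroup X) (hS : S.ExpStable) {g : ℂ → ℂ}
    (hg : ∀ z : ℂ, z.re < 0 → g z = 1) : calcOp S hS g = S.generator.domain.subtype := by
  refine calcOp_eq ⟨⟨1, fun x => ?_⟩, fun y x => ?_⟩
  · rw [one_mul]
    exact le_add_of_nonneg_right (norm_nonneg _)
  · rw [outputMap, toeplitz_eq_self hg]
    exact (memLp_orbit S hS y (x : X)).coeFn_toLp

/-- Moving the truncation point of `ε_a` to the origin turns into a left shift of the orbit. -/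
theorem inner_expTail_outputMap (S : C0Semigroup X) (hS : S.ExpStable) {g : ℂ → ℂ}
    (hg : IsHInfty g) (y : X →L[ℂ] ℂ) (x : X) {a : ℝ} (ha : 0 ≤ a) :
    inner ℂ (expTail a) (outputMap S hS g y x) =
      Complex.exp (-a) * inner ℂ (expTail 0) (outputMap S hS g y (S.orbit x a)) := by
  have hshift : toeplitz (fun z => Complex.exp (a * z)) (memLp_orbit S hS y x).toLp =
      (memLp_orbit S hS y (S.orbit x a)).toLp := by
    have hae : (fun t : ℝ => y (S.T (t + a).toNNReal x)) =ᵐ[volume.restrict (Set.Ioi (0 : ℝ))]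
        fun t : ℝ => y (S.T t.toNNReal (S.orbit x a)) := by
      filter_upwards [ae_restrict_mem measurableSet_Ioi] with t ht
      have := S.orbit_add (le_of_lt ht) ha x
      rw [← this]
      rfl
    have hm : MemLp (fun t : ℝ => y (S.T (t + a).toNNReal x)) 2
        (volume.restrict (Set.Ioi (0 : ℝ))) := (memLp_congr_ae hae).2 (memLp_orbit S hS y _)
    have hint : IntegrableOn (fun t : ℝ => y (S.T t.toNNReal x)) (Set.Ioi 0) := by
      have := hS.integrableOn_exp_smul_orbit (r := 0) le_rfl x
      simp only [zero_mul, neg_zero, Real.exp_zero, one_smul] at this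
      exact y.integrable_comp this
    rw [toeplitz_exp ha (memLp_orbit S hS y x) hint hm]
    exact (MemLp.toLp_eq_toLp_iff _ _).2 hae
  rw [outputMap, outputMap, ← hshift, ← toeplitz_mul_left hg (isHInfty_exp ha), inner_toeplitz,
    inner_toeplitz, L2.inner_def, L2.inner_def, ← integral_const_mul]
  refine integral_congr_ae ?_
  filter_upwards [laplace_expTail ha, laplace_expTail le_rfl,
    boundaryMul_coeFn hg (laplace (memLp_orbit S hS y x).toLp),
    boundaryMul_coeFn (hg.mul (isHInfty_exp ha)) (laplace (memLp_orbit S hS y x).toLp),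
    boundary_mul_ae hg (isHInfty_exp ha)] with ξ h1 h2 h3 h4 h5
  rw [h1, h2, h3, h4, h5, RCLike.inner_apply, RCLike.inner_apply, map_div₀, map_div₀,
    ← Complex.exp_conj, ← Complex.exp_conj,
    boundary_eq_of_continuous (g := fun z => Complex.exp (a * z)) (by fun_prop)]
  simp only [map_mul, map_neg, map_add, map_one, Complex.conj_ofReal, Complex.conj_I,
    Complex.conj_ofNat, mul_neg, Complex.ofReal_zero, mul_zero, map_zero, Complex.exp_zero]
  have e : Complex.exp (-(1 + -(2 * Real.pi * ξ * Complex.I)) * a) =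
      Complex.exp (-a) * Complex.exp (a * (2 * Real.pi * ξ * Complex.I)) := by
    rw [← Complex.exp_add]
    congr 1
    ring
  rw [e]
  ring

variable [CompleteSpace X]

/-- Existence of `g(A)`, in the form `g(A) x = B (x - A x)` with a bounded operator `B` that
commutes with the semigroup; thus `B = g(A) R(1, A)`. -/
theorem exists_isCalculusOp (S : C0Semigroup X) (hS : S.ExpStable) {g : ℂ → ℂ} (hg : IsHInfty g) :
    ∃ B : X →L[ℂ] X, (∀ t x, B (S.T t x) = S.T t (B x)) ∧
      IsCalculusOp S hS g (B.toLinearMap ∘ₗ (S.generator.domain.subtype - S.generator.toFun)) := by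
  obtain ⟨B, hB, hBy⟩ := hS.exists_integral_operator
    (ContinuousLinearMap.adjoint (toeplitzL hg) (expTail 0))
  have hBy' : ∀ y x, y (B x) = inner ℂ (expTail 0) (outputMap S hS g y x) := by
    intro y x
    rw [hBy, ContinuousLinearMap.adjoint_inner_left]
    rfl
  refine ⟨B, hB, ⟨‖B‖, fun x => ?_⟩, fun y x => ?_⟩
  · exact (B.le_opNorm _).trans (mul_le_mul_of_nonneg_left (norm_sub_le _ _) (norm_nonneg _))
  · have hL : outputMap S hS g y (x : X) =
        (memLp_orbit S hS (y ∘L B) ((x : X) - S.generator x)).toLp := by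
      refine eq_of_inner_expTail fun a ha => ?_
      rw [inner_expTail_outputMap S hS hg y x ha, ← hBy', inner_expTail_eq ha]
      have h1 := hS.integral_exp_smul_orbit zero_le_one x ha
      simp only [one_mul, one_smul] at h1
      have hint : IntegrableOn (fun t : ℝ => Real.exp (-t) •
          S.orbit ((x : X) - S.generator x) t) (Set.Ioi a) := by
        have := hS.integrableOn_exp_smul_orbit zero_le_one ((x : X) - S.generator x)
        simp only [one_mul] at this
        exact this.mono_set (Set.Ioi_subset_Ioi ha)
      have h2 := congrArg (y ∘L B) h1
      rw [← ContinuousLinearMap.integral_comp_comm _ hint] at h2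
      have h3 : ∫ t in Set.Ioi a, Complex.exp (-t) *
          ((memLp_orbit S hS (y ∘L B) ((x : X) - S.generator x)).toLp : ℝ → ℂ) t =
          ∫ t in Set.Ioi a, (y ∘L B) (Real.exp (-t) • S.orbit ((x : X) - S.generator x) t) := by
        refine setIntegral_congr_ae measurableSet_Ioi ?_
        filter_upwards [(ae_restrict_iff' measurableSet_Ioi).1
          (memLp_orbit S hS (y ∘L B) ((x : X) - S.generator x)).coeFn_toLp] with t ht hta
        rw [ht (lt_of_le_of_lt ha hta), ← Complex.coe_smul, map_smul, smul_eq_mul]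
        push_cast
        rfl
      rw [h3, h2, ← Complex.coe_smul, map_smul, smul_eq_mul]
      push_cast
      rfl
    rw [hL]
    filter_upwards [(memLp_orbit S hS (y ∘L B) ((x : X) - S.generator x)).coeFn_toLp] with t ht
    rw [ht]
    simp only [ContinuousLinearMap.comp_apply, LinearMap.comp_apply, LinearMap.sub_apply,
      Submodule.subtype_apply, map_sub, ContinuousLinearMap.coe_coe]
    have := S.generator_onDomain t.toNNReal x
    rw [LinearPMap.toFun_eq_coe, this]
    rfl

theorem existsUnique_isCalculusOp (S : C0Semigroup X) (hS : S.ExpStable) {g : ℂ → ℂ}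
    (hg : IsHInfty g) : ∃! C, IsCalculusOp S hS g C := by
  obtain ⟨B, -, h⟩ := exists_isCalculusOp S hS hg
  exact ⟨_, h, fun C' hC' => hC'.unique h⟩

theorem isCalculusOp_calcOp (S : C0Semigroup X) (hS : S.ExpStable) {g : ℂ → ℂ}
    (hg : IsHInfty g) : IsCalculusOp S hS g (calcOp S hS g) := by
  obtain ⟨B, -, h⟩ := exists_isCalculusOp S hS hg
  rwa [calcOp_eq h]

theorem exists_calcOp_eq (S : C0Semigroup X) (hS : S.ExpStable) {g : ℂ → ℂ} (hg : IsHInfty g) :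
    ∃ B : X →L[ℂ] X, (∀ t x, B (S.T t x) = S.T t (B x)) ∧
      ∀ x : S.generator.domain, calcOp S hS g x = B ((x : X) - S.generator x) := by
  obtain ⟨B, hB, h⟩ := exists_isCalculusOp S hS hg
  refine ⟨B, hB, fun x => ?_⟩
  rw [calcOp_eq h]
  rfl

/-! ### Algebraic rules on the domain of the generator -/

theorem calcOp_onDomain (S : C0Semigroup X) (hS : S.ExpStable) {g : ℂ → ℂ} (hg : IsHInfty g)
    (t : ℝ≥0) (x : S.generator.domain) :
    calcOp S hS g (S.onDomain t x) = S.T t (calcOp S hS g x) := by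
  obtain ⟨B, hB, h⟩ := exists_calcOp_eq S hS hg
  rw [h, h, S.generator_onDomain, ← hB, map_sub (S.T t)]
  rfl

theorem calcOp_resolvent (S : C0Semigroup X) (hS : S.ExpStable) {g : ℂ → ℂ} (hg : IsHInfty g)
    {r : ℝ} (hr : 0 ≤ r) (x : S.generator.domain) :
    calcOp S hS g (resolvent S.generator r x) =
      (resolvent S.generator r (calcOp S hS g x) : X) := by
  obtain ⟨B, hB, h⟩ := exists_calcOp_eq S hS hg
  rw [hS.coe_resolvent hr, h, h, ← hS.laplaceInt_commute hr hB, hS.coe_resolvent hr,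
    hS.generator_resolvent hr]
  congr 1
  have hadd : S.laplaceInt r ((x : X) - S.generator x) =
      S.laplaceInt r (x : X) - S.laplaceInt r (S.generator x) := by
    rw [← hS.coe_resolvent hr, ← hS.coe_resolvent hr, ← hS.coe_resolvent hr, map_sub]
    rfl
  have h1 := hS.laplaceInt_sub hr x
  have hsub : S.laplaceInt r (r • (x : X) - S.generator x) =
      r • S.laplaceInt r (x : X) - S.laplaceInt r (S.generator x) := by
    rw [← hS.coe_resolvent hr, ← hS.coe_resolvent hr, ← hS.coe_resolvent hr, map_sub,
      ← Complex.coe_smul, map_smul]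
    rfl
  rw [hadd, sub_right_inj]
  exact (eq_sub_of_add_eq (eq_sub_iff_add_eq'.1 (h1.symm.trans hsub))).symm

theorem continuous_calcOp_resolvent (S : C0Semigroup X) (hS : S.ExpStable) {g : ℂ → ℂ}
    (hg : IsHInfty g) {r : ℝ} (hr : 0 ≤ r) :
    Continuous fun x => calcOp S hS g (resolvent S.generator r x) := by
  obtain ⟨B, -, h⟩ := exists_calcOp_eq S hS hg
  simp only [h, hS.coe_resolvent hr, hS.generator_resolvent hr]
  have := hS.continuous_laplaceInt hr
  fun_prop

theorem calcOp_add (S : C0Semigroup X) (hS : S.ExpStable) {g₁ g₂ : ℂ → ℂ} (h₁ : IsHInfty g₁)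
    (h₂ : IsHInfty g₂) : calcOp S hS (g₁ + g₂) = calcOp S hS g₁ + calcOp S hS g₂ := by
  obtain ⟨⟨K₁, hK₁⟩, e₁⟩ := isCalculusOp_calcOp S hS h₁
  obtain ⟨⟨K₂, hK₂⟩, e₂⟩ := isCalculusOp_calcOp S hS h₂
  refine calcOp_eq ⟨⟨K₁ + K₂, fun x => ?_⟩, fun y x => ?_⟩
  · refine (norm_add_le _ _).trans ((add_le_add (hK₁ x) (hK₂ x)).trans (le_of_eq ?_))
    ring
  · have h : outputMap S hS (g₁ + g₂) y (x : X) =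
        outputMap S hS g₁ y (x : X) + outputMap S hS g₂ y (x : X) := toeplitz_add_left h₁ h₂ _
    rw [h]
    filter_upwards [Lp.coeFn_add (outputMap S hS g₁ y (x : X)) (outputMap S hS g₂ y (x : X)),
      e₁ y x, e₂ y x] with t h1 h2 h3
    rw [h1, Pi.add_apply, h2, h3, LinearMap.add_apply, map_add]

/-- Multiplicativity of the calculus, for elements `w = g₂(A) x` that lie in `D(A)`. -/
theorem calcOp_mul_of_mem (S : C0Semigroup X) (hS : S.ExpStable) {g₁ g₂ : ℂ → ℂ}
    (h₁ : IsHInfty g₁) (h₂ : IsHInfty g₂) {x w : S.generator.domain}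
    (hw : calcOp S hS g₂ x = w) : calcOp S hS (g₁ * g₂) x = calcOp S hS g₁ w := by
  refine SeparatingDual.eq_iff_forall_dual_eq (R := ℂ) |>.2 fun y => ?_
  have e₂ : outputMap S hS g₂ y (x : X) = (memLp_orbit S hS y (w : X)).toLp := by
    refine Lp.ext (((isCalculusOp_calcOp S hS h₂).2 y x).trans ?_)
    filter_upwards [(memLp_orbit S hS y (w : X)).coeFn_toLp] with t ht
    rw [ht, calcOp_onDomain S hS h₂, hw]
  have e : outputMap S hS (g₁ * g₂) y (x : X) = outputMap S hS g₁ y (w : X) := by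
    rw [outputMap, toeplitz_mul_left h₁ h₂]
    exact congrArg (toeplitz g₁) e₂
  have h := ((isCalculusOp_calcOp S hS (h₁.mul h₂)).2 y x).symm.trans
    ((Filter.EventuallyEq.of_eq (congrArg (fun f : L2Pos => (f : ℝ → ℂ)) e)).trans ((isCalculusOp_calcOp S hS h₁).2 y w))
  simp only [calcOp_onDomain S hS h₁, calcOp_onDomain S hS (h₁.mul h₂)] at h
  have h0 := apply_zero_eq_of_ae_eq
    (y.continuous.comp (S.continuous_orbit_real _)) (y.continuous.comp (S.continuous_orbit_real _)) h
  simpa [C0Semigroup.orbit_zero] using h0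

/-! ### Lambda extensions -/

theorem calcExt_one (S : C0Semigroup X) (hS : S.ExpStable) {g : ℂ → ℂ}
    (hg : ∀ z : ℂ, z.re < 0 → g z = 1) : calcExt S hS g = opId X := by
  have hgraph : ∀ x, (x, x) ∈ (calcExt S hS g).graph := by
    intro x
    rw [mem_graph_calcExt, calcOp_one S hS hg]
    refine (hS.tendsto_smul_laplaceInt x).congr' ?_
    filter_upwards [eventually_ge_atTop 0] with r hr
    rw [Complex.coe_smul, Submodule.subtype_apply, hS.coe_resolvent hr]
  refine (LinearPMap.eq_of_le_of_domain_eq (LinearPMap.le_of_le_graph ?_) ?_).symm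
  · intro p hp
    obtain ⟨x, h1, h2⟩ := LinearPMap.mem_graph_iff _ |>.1 hp
    have h3 : p = (p.1, p.1) := Prod.ext rfl (h2.symm.trans h1)
    rw [h3]
    exact hgraph _
  · refine Eq.symm (Submodule.eq_top_iff'.2 fun x => ?_)
    exact (mem_domain_calcExt S hS g).2 ⟨x, hgraph x⟩

theorem add_calcExt_le (S : C0Semigroup X) (hS : S.ExpStable) {g₁ g₂ : ℂ → ℂ} (h₁ : IsHInfty g₁)
    (h₂ : IsHInfty g₂) : calcExt S hS g₁ + calcExt S hS g₂ ≤ calcExt S hS (g₁ + g₂) := by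
  refine LinearPMap.le_of_le_graph ?_
  rintro ⟨x, z⟩ h
  obtain ⟨u, v, hu, hv, rfl⟩ := mem_graph_add.1 h
  rw [mem_graph_calcExt] at hu hv ⊢
  simpa [calcOp_add S hS h₁ h₂] using hu.add hv

/-- The key identity `(g₁ g₂)(A) R(r, A) x = g₁(A) R(r, A) g₂,Λ(A) x`. It holds for `x ∈ D(A)`
with `g₂(A)` in place of its extension; approximate a general `x` by `μ R(μ, A) x`. -/
theorem calcOp_mul_resolvent (S : C0Semigroup X) (hS : S.ExpStable) {g₁ g₂ : ℂ → ℂ}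
    (h₁ : IsHInfty g₁) (h₂ : IsHInfty g₂) {x u : X} (hu : (x, u) ∈ (calcExt S hS g₂).graph)
    {r : ℝ} (hr : 0 ≤ r) :
    calcOp S hS (g₁ * g₂) (resolvent S.generator r x) =
      calcOp S hS g₁ (resolvent S.generator r u) := by
  rw [mem_graph_calcExt] at hu
  have hdom : ∀ x : S.generator.domain, calcOp S hS (g₁ * g₂) (resolvent S.generator r x) =
      calcOp S hS g₁ (resolvent S.generator r (calcOp S hS g₂ x)) := fun x =>
    calcOp_mul_of_mem S hS h₁ h₂ (calcOp_resolvent S hS h₂ hr x)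
  have hl := ((continuous_calcOp_resolvent S hS (h₁.mul h₂) hr).tendsto x).comp
    (hS.tendsto_smul_laplaceInt x)
  have hlim := ((continuous_calcOp_resolvent S hS h₁ hr).tendsto u).comp hu
  refine tendsto_nhds_unique (hl.congr' ?_) hlim
  filter_upwards [eventually_ge_atTop 0] with m hm
  have h := hdom ((m : ℂ) • resolvent S.generator m x)
  rw [map_smul (calcOp S hS g₂), Submodule.coe_smul, hS.coe_resolvent hm, Complex.coe_smul] at h
  exact h

theorem mem_graph_mul_iff (S : C0Semigroup X) (hS : S.ExpStable) {g₁ g₂ : ℂ → ℂ}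
    (h₁ : IsHInfty g₁) (h₂ : IsHInfty g₂) {x u z : X} (hu : (x, u) ∈ (calcExt S hS g₂).graph) :
    (x, z) ∈ (calcExt S hS (g₁ * g₂)).graph ↔ (u, z) ∈ (calcExt S hS g₁).graph := by
  rw [mem_graph_calcExt, mem_graph_calcExt]
  refine tendsto_congr' ?_
  filter_upwards [eventually_ge_atTop 0] with r hr
  rw [calcOp_mul_resolvent S hS h₁ h₂ hu hr]

theorem opMul_calcExt_le (S : C0Semigroup X) (hS : S.ExpStable) {g₁ g₂ : ℂ → ℂ}
    (h₁ : IsHInfty g₁) (h₂ : IsHInfty g₂) :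
    opMul (calcExt S hS g₁) (calcExt S hS g₂) ≤ calcExt S hS (g₁ * g₂) := by
  refine LinearPMap.le_of_le_graph ?_
  rintro ⟨x, z⟩ h
  obtain ⟨u, hu, hz⟩ := mem_graph_opMul.1 h
  exact (mem_graph_mul_iff S hS h₁ h₂ hu).2 hz

theorem domain_opMul_calcExt (S : C0Semigroup X) (hS : S.ExpStable) {g₁ g₂ : ℂ → ℂ}
    (h₁ : IsHInfty g₁) (h₂ : IsHInfty g₂) :
    (opMul (calcExt S hS g₁) (calcExt S hS g₂)).domain =
      (calcExt S hS (g₁ * g₂)).domain ⊓ (calcExt S hS g₂).domain := by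
  ext x
  rw [Submodule.mem_inf, LinearPMap.mem_domain_iff, mem_domain_calcExt, mem_domain_calcExt]
  simp only [mem_graph_opMul]
  constructor
  · rintro ⟨z, u, hu, hz⟩
    exact ⟨⟨z, (mem_graph_mul_iff S hS h₁ h₂ hu).2 hz⟩, u, hu⟩
  · rintro ⟨⟨z, hz⟩, u, hu⟩
    exact ⟨z, u, hu, (mem_graph_mul_iff S hS h₁ h₂ hu).1 hz⟩

/-- If `g(A)` is bounded in the norm of `X`, then `g_Λ(A)` is defined everywhere: it is the
continuous extension of `g(A)` from the dense subspace `D(A)`. -/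
theorem domain_calcExt_eq_top (S : C0Semigroup X) (hS : S.ExpStable) {g : ℂ → ℂ} {K : ℝ}
    (hK : ∀ x : S.generator.domain, ‖calcOp S hS g x‖ ≤ K * ‖(x : X)‖) :
    (calcExt S hS g).domain = ⊤ := by
  refine Submodule.eq_top_iff'.2 fun x => (mem_domain_calcExt S hS g).2 ?_
  simp only [mem_graph_calcExt]
  have hc : CauchySeq fun r : ℝ => r • S.laplaceInt r x :=
    (hS.tendsto_smul_laplaceInt x).cauchySeq
  have hlip : ∀ x x' : S.generator.domain,
      dist (calcOp S hS g x) (calcOp S hS g x') ≤ |K| * dist (x : X) (x' : X) := by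
    intro x x'
    rw [dist_eq_norm, dist_eq_norm, ← map_sub]
    exact (hK _).trans (mul_le_mul_of_nonneg_right (le_abs_self K) (norm_nonneg _))
  refine cauchySeq_tendsto_of_complete ?_
  rw [Metric.cauchySeq_iff] at hc ⊢
  intro ε hε
  obtain ⟨N, hN⟩ := hc (ε / (|K| + 1)) (by positivity)
  refine ⟨max N 0, fun m hm n hn => ?_⟩
  have h := hN m (le_of_max_le_left hm) n (le_of_max_le_left hn)
  rw [lt_div_iff₀ (by positivity)] at h
  have hsmul : ∀ r : ℝ, (r : ℂ) • calcOp S hS g (resolvent S.generator r x) =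
      calcOp S hS g ((r : ℂ) • resolvent S.generator r x) := fun r => (map_smul _ _ _).symm
  rw [hsmul m, hsmul n]
  refine (hlip _ _).trans_lt (lt_of_le_of_lt ?_ h)
  rw [Submodule.coe_smul, Submodule.coe_smul, hS.coe_resolvent (le_of_max_le_right hm),
    hS.coe_resolvent (le_of_max_le_right hn), Complex.coe_smul, Complex.coe_smul, mul_comm]
  gcongr
  linarith

theorem calcExt_add_eq (S : C0Semigroup X) (hS : S.ExpStable) {g₁ g₂ : ℂ → ℂ} (h₁ : IsHInfty g₁)
    (h₂ : IsHInfty g₂) (htop : (calcExt S hS g₂).domain = ⊤) :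
    calcExt S hS (g₁ + g₂) = calcExt S hS g₁ + calcExt S hS g₂ := by
  refine (LinearPMap.eq_of_le_of_domain_eq (add_calcExt_le S hS h₁ h₂) ?_).symm
  refine le_antisymm (add_calcExt_le S hS h₁ h₂).1 fun x hx => ?_
  have hx₂ : x ∈ (calcExt S hS g₂).domain := htop ▸ Submodule.mem_top
  refine ⟨?_, hx₂⟩
  obtain ⟨z, hz⟩ := (mem_domain_calcExt S hS _).1 hx
  obtain ⟨u, hu⟩ := (mem_domain_calcExt S hS _).1 hx₂
  refine (mem_domain_calcExt S hS g₁).2 ⟨z - u, ?_⟩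
  rw [mem_graph_calcExt] at hz hu ⊢
  simpa [calcOp_add S hS h₁ h₂] using hz.sub hu

theorem calcExt_mul_eq (S : C0Semigroup X) (hS : S.ExpStable) {g₁ g₂ : ℂ → ℂ} (h₁ : IsHInfty g₁)
    (h₂ : IsHInfty g₂) (htop : (calcExt S hS g₂).domain = ⊤) :
    calcExt S hS (g₁ * g₂) = opMul (calcExt S hS g₁) (calcExt S hS g₂) := by
  refine (LinearPMap.eq_of_le_of_domain_eq (opMul_calcExt_le S hS h₁ h₂) ?_).symm
  rw [domain_opMul_calcExt S hS h₁ h₂, htop, inf_top_eq]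

end Existence

end WeakCalc

end

theorem theorem2p12 {X : Type*} [NormedAddCommGroup X] [NormedSpace ℂ X] [CompleteSpace X]
    (S : WeakCalc.C0Semigroup X) (hS : S.ExpStable) :
    -- `g(A)` is well defined
    (∀ g : ℂ → ℂ, WeakCalc.IsHInfty g → ∃! C, WeakCalc.IsCalculusOp S hS g C) ∧
    -- `g ≡ 1` gives the identity
    (∀ g : ℂ → ℂ, (∀ z : ℂ, z.re < 0 → g z = 1) →
      (∀ x : S.generator.domain, WeakCalc.calcOp S hS g x = (x : X)) ∧
      WeakCalc.calcExt S hS g = WeakCalc.opId X) ∧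
    -- sums and products
    (∀ g₁ g₂ : ℂ → ℂ, WeakCalc.IsHInfty g₁ → WeakCalc.IsHInfty g₂ →
      WeakCalc.calcExt S hS g₁ + WeakCalc.calcExt S hS g₂ ≤ WeakCalc.calcExt S hS (g₁ + g₂) ∧
      WeakCalc.opMul (WeakCalc.calcExt S hS g₁) (WeakCalc.calcExt S hS g₂) ≤
        WeakCalc.calcExt S hS (g₁ * g₂) ∧
      (WeakCalc.opMul (WeakCalc.calcExt S hS g₁) (WeakCalc.calcExt S hS g₂)).domain =
        (WeakCalc.calcExt S hS (g₁ * g₂)).domain ⊓ (WeakCalc.calcExt S hS g₂).domain ∧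
      -- equality when `g₂(A)` is bounded in the norm of `X`
      ((∃ K : ℝ, ∀ x : S.generator.domain, ‖WeakCalc.calcOp S hS g₂ x‖ ≤ K * ‖(x : X)‖) →
        WeakCalc.calcExt S hS (g₁ + g₂) = WeakCalc.calcExt S hS g₁ + WeakCalc.calcExt S hS g₂ ∧
        WeakCalc.calcExt S hS (g₁ * g₂) =
          WeakCalc.opMul (WeakCalc.calcExt S hS g₁) (WeakCalc.calcExt S hS g₂))) := by
  refine ⟨fun g hg => WeakCalc.existsUnique_isCalculusOp S hS hg,
    fun g hg => ⟨fun x => by rw [WeakCalc.calcOp_one S hS hg]; rfl, WeakCalc.calcExt_one S hS hg⟩,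
    fun g₁ g₂ h₁ h₂ => ⟨WeakCalc.add_calcExt_le S hS h₁ h₂, WeakCalc.opMul_calcExt_le S hS h₁ h₂,
      WeakCalc.domain_opMul_calcExt S hS h₁ h₂, fun ⟨K, hK⟩ => ?_⟩⟩
  have htop := WeakCalc.domain_calcExt_eq_top S hS hK
  exact ⟨WeakCalc.calcExt_add_eq S hS h₁ h₂ htop, WeakCalc.calcExt_mul_eq S hS h₁ h₂ htop⟩
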